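/- Let $(\mathsf C,\mathsf P,\Pi,\mathsf P^\vee,\Pi^\vee)$ be a Cartan datum of finite type with connected Dynkin diagram $\triangle$ with vertex set $I$: Cartan matrix $\mathsf C=(\mathsf c_{i,j})_{i,j\in I}$, simple roots $\alpha_i$, simple coroots $h_i$, fundamental weights $\varpi_i$, and symmetric bilinear form $(\cdot,\cdot)$ normalized by $(\alpha,\alpha)=2$ for short roots. Put $d_i=(\alpha_i,\alpha_i)/2$ and $\mathsf D=\mathrm{diag}(d_i\mid i\in I)$, let $d(i,j)$ be the distance between $i$ and $j$ in $\triangle$, let $\mathsf W$ be the Weyl group, generated by the simple reflections $s_i$, let $\mathsf h$ be the Coxeter number, let $w_0$ be the longest element of $\mathsf W$, and let $i\mapsto i^*$ be the map $I\to I$ with $w_0(\alpha_i)=-\alpha_{i^*}$. Let $\underline{\mathsf C}(t)$ be the matrix with entries $\underline{\mathsf C}_{i,i}(t)=t+t^{-1}$ and $\underline{\mathsf C}_{i,j}(t)=\mathsf c_{i,j}$ for $i\ne j$, let $\underline{\mathsf B}(t)=\underline{\mathsf C}(t)\mathsf D^{-1}$, which is invertible over $\mathbb Q(t)$, and let $$\bigl(\underline{\mathsf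 B}(t)^{-1}\bigr)_{i,j}=\sum_{u\in\mathbb Z}\widetilde{\mathsf b}_{i,j}(u)\,t^u$$ be the Laurent expansion at $t=0$. For a height function $\xi$, i.e. a function $\xi\colon I\to\mathbb Z$ with $|\xi_i-\xi_j|=1$ whenever $d(i,j)=1$, let $Q=(\triangle,\xi)$ be the corresponding Dynkin quiver, with an arrow $i\to j$ when $d(i,j)=1$ and $\xi_i=\xi_j+1$. A vertex $i$ is a source of $Q$ if $\xi_i>\xi_j$ for all $j$ with $d(i,j)=1$, and then $s_iQ=(\triangle,s_i\xi)$ with $(s_i\xi)_j=\xi_j-2\delta(i=j)$. Let $\tau_Q=s_{i_1}\cdots s_{i_n}$ be the Coxeter element for which $i_1,\dots,i_n$ is an enumeration without repetition of $I$ and $i_k$ is a source of $s_{i_{k-1}}\cdots s_{i_1}Q$ for all $k$, and put $\gamma_j^Q=(1-\tau_Q)\varpi_j$. Then, for all $i,j\in I$ and $u\in\mathbb Z$: 1. $\widetilde{\mathsf b}_{i,j}(u)=0$ unless $u\ge1$ and $u\equiv d(i,j)+1 \pmod 2$. 2. $\widetilde{\mathsf b}_{i,j}(u+\mathsf h)=-\widetilde{\mathsf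 b}_{i,j^*}(u)$ for $u\ge0$. In particular, $\widetilde{\mathsf b}_{i,j}(\mathsf h)=0$. 3. $\widetilde{\mathsf b}_{i,j}(u+2\mathsf h)=\widetilde{\mathsf b}_{i,j}(u)$ for $u\ge0$. 4. $\widetilde{\mathsf b}_{i,j}(\mathsf h-u)=\widetilde{\mathsf b}_{i,j^*}(u)$ for $0\le u\le\mathsf h$. 5. $\widetilde{\mathsf b}_{i,j}(2\mathsf h-u)=-\widetilde{\mathsf b}_{i,j}(u)$ for $0\le u\le2\mathsf h$. 6. $\widetilde{\mathsf b}_{i,j}(u)\ge0$ for $0\le u\le\mathsf h$. 7. $\widetilde{\mathsf b}_{i,j}(u)\le0$ for $\mathsf h\le u\le2\mathsf h$. 8. For every Dynkin quiver $Q=(\triangle,\xi)$, $$\widetilde{\mathsf b}_{i,j}(u)-\widetilde{\mathsf b}_{i,j}(-u)=\begin{cases}\bigl(\varpi_i,\ \tau_Q^{(u+\xi_j-\xi_i-1)/2}(\gamma_j^Q)\bigr)&\text{if } u+\xi_j-\xi_i-1\in2\mathbb Z,\\ 0&\text{otherwise.}\end{cases}$$ -/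

import Mathlib

/-- A Cartan datum of finite type with connected Dynkin diagram, with index set `I` and weight
lattice `P`.  The bilinear form is normalized so that short roots have square length `2`. -/
structure FiniteCartanDatum (I P : Type*) [Fintype I] [AddCommGroup P] where
  /-- the Cartan matrix `(c_{i,j})` -/
  C : Matrix I I ℤ
  /-- the simple roots `α_i` -/
  α : I → P
  /-- the simple coroots `h_i` in the coweight lattice `Hom(P, ℤ)` -/
  coroot : I → Module.Dual ℤ P
  /-- the fundamental weights `ϖ_i` -/
  ϖ : I → P
  /-- the symmetric `ℚ`-valued bilinear form `(·, ·)` on `P` -/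
  form : P →ₗ[ℤ] P →ₗ[ℤ] ℚ
  C_diag : ∀ i, C i i = 2
  C_nonpos : ∀ i j, i ≠ j → C i j ≤ 0
  C_eq_zero : ∀ i j, C i j = 0 → C j i = 0
  coroot_α : ∀ i j, coroot i (α j) = C i j
  linearIndependent_α : LinearIndependent ℤ α
  coroot_ϖ_self : ∀ i, coroot i (ϖ i) = 1
  coroot_ϖ_ne : ∀ i j, i ≠ j → coroot j (ϖ i) = 0
  form_symm : ∀ x y, form x y = form y x
  form_α_pos : ∀ i, 0 < form (α i) (α i)
  coroot_eq : ∀ i x, (coroot i x : ℚ) = 2 * form (α i) x / form (α i) (α i)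
  /-- finite type: the Gram matrix of the simple roots is positive definite -/
  form_posDef : ∀ x : I → ℚ, x ≠ 0 → 0 < ∑ i, ∑ j, x i * x j * form (α i) (α j)
  /-- Each root is conjugate to a simple root under the Weyl group, so the short roots are the
  conjugates of the simple roots of least square length. -/
  form_short : (∀ i, 2 ≤ form (α i) (α i)) ∧ ∃ i, form (α i) (α i) = 2
  /-- connectedness: the Dynkin diagram is connected and nonempty -/
  connected : (SimpleGraph.fromRel fun i j => C i j < 0).Connected

namespace FiniteCartanDatum

variable {I P : Type*} [Fintype I] [AddCommGroup P] (D : FiniteCartanDatum I P)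

/-! ### Dynkin diagram and Weyl group -/

/-- The Dynkin diagram, as a graph on `I`; `d(i, j)` is `D.diagram.dist i j`. -/
def diagram : SimpleGraph I := SimpleGraph.fromRel fun i j => D.C i j < 0

/-- `d_i = (α_i, α_i) / 2`. -/
def d (i : I) : ℚ := D.form (D.α i) (D.α i) / 2

theorem coroot_self (i : I) : D.coroot i (D.α i) = 2 := by
  rw [D.coroot_α, D.C_diag]

/-- The simple reflection `s_i λ = λ - ⟨h_i, λ⟩ α_i`. -/
def s (i : I) : P ≃ₗ[ℤ] P := Module.reflection (D.coroot_self i)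

theorem s_apply (i : I) (x : P) : D.s i x = x - D.coroot i x • D.α i :=
  Module.reflection_apply _ _

/-- The Weyl group, as a subgroup of `Aut(P)`. -/
def weylGroup : Subgroup (P ≃ₗ[ℤ] P) := Subgroup.closure (Set.range D.s)

/-- The product `s_{i_1} ⋯ s_{i_l}`. -/
def wordProd (l : List I) : P ≃ₗ[ℤ] P := (l.map D.s).prod

/-- The length of an element of the Weyl group: the least length of an expression as a product
of simple reflections. -/
noncomputable def length (w : P ≃ₗ[ℤ] P) : ℕ :=
  sInf {n | ∃ l : List I, l.length = n ∧ D.wordProd l = w}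

/-- `w` is an element of the Weyl group of largest length. -/
def IsLongest (w : P ≃ₗ[ℤ] P) : Prop :=
  w ∈ D.weylGroup ∧ ∀ v ∈ D.weylGroup, D.length v ≤ D.length w

/-- The Coxeter number: the order of a Coxeter element, i.e. of a product of all simple
reflections, each taken once.  (All Coxeter elements are conjugate, so the order in which the
simple reflections are multiplied does not matter.) -/
noncomputable def coxeterNumber : ℕ := orderOf (D.wordProd Finset.univ.toList)

/-! ### Dynkin quivers and their Coxeter elements -/

/-- `ξ` is a height function, i.e. `(D.diagram, ξ)` is a Dynkin quiver; its arrows are `i → j`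
for adjacent `i`, `j` with `ξ i = ξ j + 1`. -/
def IsHeightFunction (ξ : I → ℤ) : Prop := ∀ i j, D.diagram.Adj i j → |ξ i - ξ j| = 1

/-- `i` is a source of the Dynkin quiver `(D.diagram, ξ)`. -/
def IsSource (ξ : I → ℤ) (i : I) : Prop := ∀ j, D.diagram.Adj i j → ξ j < ξ i

/-- The height function `s_i ξ` of the reflected quiver. -/
def reflect [DecidableEq I] (i : I) (ξ : I → ℤ) : I → ℤ := fun j => ξ j - if i = j then 2 else 0

/-- The word `s_{i_1} ⋯ s_{i_l}` is adapted to `Q = (D.diagram, ξ)`: each `i_k` is a source of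
`s_{i_{k-1}} ⋯ s_{i_1} Q`. -/
def IsAdapted [DecidableEq I] : (I → ℤ) → List I → Prop
  | _, [] => True
  | ξ, i :: l => D.IsSource ξ i ∧ IsAdapted (reflect i ξ) l

/-- `τ` is the Coxeter element `τ_Q` of `Q = (D.diagram, ξ)`: a product of all simple
reflections, each taken once, in an order adapted to `Q`.  (Such a word is automatically
reduced.) -/
def IsCoxeterElementOf [DecidableEq I] (ξ : I → ℤ) (τ : P ≃ₗ[ℤ] P) : Prop :=
  ∃ l : List I, l.Nodup ∧ (∀ i, i ∈ l) ∧ D.IsAdapted ξ l ∧ D.wordProd l = τ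

theorem isAdapted_of_sorted [DecidableEq I] (l : List I) : ∀ ξ : I → ℤ, l.Nodup →
    l.Pairwise (fun a b => ξ b ≤ ξ a) →
    (∀ a ∈ l, ∀ b ∈ l, D.diagram.Adj a b → |ξ a - ξ b| = 1) →
    (∀ a ∈ l, ∀ b, b ∉ l → D.diagram.Adj a b → ξ b < ξ a) → D.IsAdapted ξ l := by
  induction l with
  | nil => intros; trivial
  | cons i l ih =>
    intro ξ hnd hpw hadj hout
    rw [List.nodup_cons] at hnd
    rw [List.pairwise_cons] at hpw
    have hne : ∀ a ∈ l, i ≠ a := fun a ha h => hnd.1 (h ▸ ha)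
    have hr : ∀ a ∈ l, reflect i ξ a = ξ a := fun a ha => by simp [reflect, hne a ha]
    refine ⟨?_, ih (reflect i ξ) hnd.2 ?_ ?_ ?_⟩
    · intro j hj
      by_cases hjl : j ∈ l
      · have h1 := hadj i (by simp) j (by simp [hjl]) hj
        have h2 := hpw.1 j hjl
        rw [abs_of_nonneg (by omega)] at h1
        omega
      · exact hout i (by simp) j (by simp [hjl, hj.ne']) hj
    · refine hpw.2.imp_of_mem ?_
      intro a b ha hb h
      rw [hr a ha, hr b hb]
      exact h
    · intro a ha b hb h
      rw [hr a ha, hr b hb]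
      exact hadj a (by simp [ha]) b (by simp [hb]) h
    · intro a ha b hb h
      rw [hr a ha]
      by_cases hib : i = b
      · subst hib
        have h1 := hadj a (by simp [ha]) i (by simp) h
        have h2 := hpw.1 a ha
        rw [abs_of_nonpos (by omega)] at h1
        simp only [reflect, if_true]
        omega
      · have h1 := hout a (by simp [ha]) b (by simp [hb, Ne.symm hib]) h
        simpa [reflect, hib] using h1

/-- Every Dynkin quiver has a Coxeter element adapted to it. -/
theorem exists_isCoxeterElementOf [DecidableEq I] {ξ : I → ℤ} (hξ : D.IsHeightFunction ξ) :
    ∃ τ, D.IsCoxeterElementOf ξ τ := by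
  let l := (Finset.univ : Finset I).toList.mergeSort (fun a b => decide (ξ b ≤ ξ a))
  have hperm : l.Perm Finset.univ.toList := List.mergeSort_perm _ _
  have hmem : ∀ i, i ∈ l := fun i => hperm.mem_iff.2 (by simp)
  refine ⟨_, l, hperm.nodup_iff.2 (Finset.nodup_toList _), hmem, ?_, rfl⟩
  refine D.isAdapted_of_sorted l ξ (hperm.nodup_iff.2 (Finset.nodup_toList _)) ?_
    (fun a _ b _ h => hξ a b h) (fun _ _ b hb => absurd (hmem b) hb)
  have := List.pairwise_mergeSort (le := fun a b : I => decide (ξ b ≤ ξ a))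
    (by intro a b c; simp only [decide_eq_true_eq]; omega)
    (by intro a b; simp only [Bool.or_eq_true, decide_eq_true_eq]; omega)
    (Finset.univ : Finset I).toList
  simpa using this

/-- `γ_j^Q = (1 - τ_Q) ϖ_j`, for `τ = τ_Q`. -/
def γ (τ : P ≃ₗ[ℤ] P) (j : I) : P := D.ϖ j - τ (D.ϖ j)

/-! ### The `t`-quantized Cartan matrix -/

/-- The adjacency matrix `2 - C`. -/
def adjMatrix [DecidableEq I] : Matrix I I ℤ := fun i j => (if i = j then 2 else 0) - D.C i j

/-- The `t`-quantized Cartan matrix, with entries `(t + t⁻¹) δ(i = j) - (2 δ(i = j) - c_{i,j})`: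
the specialization at `q = 1` of the `(q, t)`-Cartan matrix, whose entries are
`(q_i t⁻¹ + q_i⁻¹ t) δ(i = j) - [2 δ(i = j) - c_{i,j}]_q`. -/
noncomputable def tCartan [DecidableEq I] : Matrix I I (RatFunc ℚ) := fun i j =>
  (if i = j then RatFunc.X + RatFunc.X⁻¹ else 0) - (D.adjMatrix i j : RatFunc ℚ)

/-- The symmetric matrix `B(t) = C(t) diag(d_i)⁻¹`. -/
noncomputable def tB [DecidableEq I] : Matrix I I (RatFunc ℚ) :=
  D.tCartan * Matrix.diagonal fun i => RatFunc.C (D.d i)⁻¹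

/-- `B(t)` is invertible over `ℚ(t)`. -/
theorem isUnit_det_tB [DecidableEq I] : IsUnit D.tB.det := by
  have hX : (RatFunc.X : RatFunc ℚ) ≠ 0 := RatFunc.X_ne_zero
  let M : Matrix I I (Polynomial ℚ) := fun i j =>
    (if i = j then Polynomial.X ^ 2 + 1 else 0) - Polynomial.X * (D.adjMatrix i j : Polynomial ℚ)
  have hM : M.det ≠ 0 := by
    intro h
    have h0 : (M.map (Polynomial.evalRingHom (0 : ℚ))) = 1 := by
      ext i j
      rw [Matrix.map_apply]
      by_cases hij : i = j <;> simp [M, Matrix.one_apply, hij]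
    have h1 := RingHom.map_det (Polynomial.evalRingHom (0 : ℚ)) M
    rw [h, map_zero] at h1
    have h2 : (Polynomial.evalRingHom (0 : ℚ)).mapMatrix M = 1 := h0
    rw [h2, Matrix.det_one] at h1
    exact zero_ne_one h1
  have hC : D.tCartan.det ≠ 0 := by
    intro h
    apply hM
    have hinj := IsFractionRing.injective (Polynomial ℚ) (RatFunc ℚ)
    apply hinj
    have h1 : (algebraMap (Polynomial ℚ) (RatFunc ℚ)).mapMatrix M =
        (RatFunc.X : RatFunc ℚ) • D.tCartan := by
      ext i j
      rw [RingHom.mapMatrix_apply, Matrix.map_apply]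
      by_cases hij : i = j
      · simp only [M, tCartan, hij, if_true, Matrix.smul_apply, smul_eq_mul, map_sub, map_add,
          map_mul, map_pow, map_one, RatFunc.algebraMap_X, map_intCast]
        field_simp
      · simp [M, tCartan, hij]
    rw [RingHom.map_det, h1, Matrix.det_smul, h, mul_zero, map_zero]
  have hd : ∀ i, (RatFunc.C (D.d i)⁻¹ : RatFunc ℚ) ≠ 0 := by
    intro i
    have h1 : (0 : ℚ) < D.d i := half_pos (D.form_α_pos i)
    rw [← map_zero (RatFunc.C : ℚ →+* RatFunc ℚ)]
    exact fun h => (inv_ne_zero h1.ne') ((RatFunc.C : ℚ →+* RatFunc ℚ).injective h)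
  rw [isUnit_iff_ne_zero, tB, Matrix.det_mul, Matrix.det_diagonal]
  exact mul_ne_zero hC (Finset.prod_ne_zero_iff.2 fun i _ => hd i)

/-- The coefficient of `t ^ u` in the Laurent expansion at `t = 0` of the `(i, j)` entry of the
inverse of `B(t)`. -/
noncomputable def b [DecidableEq I] (i j : I) (u : ℤ) : ℚ :=
  (D.tB⁻¹ i j : LaurentSeries ℚ).coeff u

end FiniteCartanDatum

namespace FiniteCartanDatum

variable {I P : Type*} [Fintype I] [AddCommGroup P] (D : FiniteCartanDatum I P)

/-! ### The Cartan matrix and the form -/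

/-! Put A = 2 - C. Comparing coefficients in B(t) B(t)⁻¹ = 1 shows that `b i j u / d i` obeys the
Chebyshev recurrence driven by A, with value 0 at u = 0 and the identity at u = 1. Hence for u ≥ 0
it is the entry of `cheb u` = U_{u-1}(A/2) (`b_eq_cheb`), and everything becomes a statement about
these integer matrices.

Signs come from roots. The sum of two consecutive columns of `cheb` is the coefficient vector of a
root, obtained by alternately applying the two commuting halves of a bipartite Coxeter element
(`IsHeightFunction.wordProd_parityClass`), so its entries have one sign. The two summands are
supported on vertices of opposite parity, so nonnegativity passes from `cheb n` to `cheb (n + 1)`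
until a column vanishes. One must vanish: paired with a nonnegative v satisfying vC = (1, ..., 1),
the columns would otherwise form a nonnegative sequence with second differences at most -1.
Connectedness then spreads the zero over a whole matrix `cheb m` (`exists_first_zero_cheb`).

Reflecting the recurrence about m gives the symmetries and the period 2m. The matrix `cheb (m - 1)`
is nonnegative with square 1, hence a permutation matrix, which defines the star map; the
alternating product with m factors sends α_j to -α_{j*}, so it is the longest element
(`isLongest_iff`).

For the Coxeter formula, the vectors τ^k γ_j satisfy mesh relations, so their pairings with ϖ_i obey
the same recurrence, with the same two initial rows (`IsCoxeterElementOf.form_ϖ_repetition`). This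
formula also transfers periods between τ and `cheb`, which identifies m with the Coxeter number. -/

theorem d_pos (i : I) : 0 < D.d i := half_pos (D.form_α_pos i)

theorem form_α_eq (i : I) (x : P) : D.form (D.α i) x = D.d i * D.coroot i x := by
  have h := D.form_α_pos i
  rw [D.coroot_eq, d]
  field_simp

theorem form_α_α (i j : I) : D.form (D.α i) (D.α j) = D.d i * D.C i j := by
  rw [form_α_eq, D.coroot_α]

theorem form_ϖ_α [DecidableEq I] (i j : I) :
    D.form (D.ϖ i) (D.α j) = if i = j then D.d i else 0 := by
  rw [D.form_symm, form_α_eq]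
  split_ifs with h
  · subst h; simp [D.coroot_ϖ_self]
  · simp [D.coroot_ϖ_ne i j h]

theorem d_mul_C_comm (i j : I) : D.d i * D.C i j = D.d j * D.C j i := by
  rw [← form_α_α, ← form_α_α, D.form_symm]

theorem adj_iff (i j : I) : D.diagram.Adj i j ↔ i ≠ j ∧ D.C i j ≠ 0 := by
  rw [diagram, SimpleGraph.fromRel_adj]
  refine and_congr_right fun h => ⟨?_, fun h0 => Or.inl (lt_of_le_of_ne (D.C_nonpos i j h) h0)⟩
  rintro (h1 | h1) h0
  · omega
  · have := D.C_eq_zero i j h0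
    omega

section adjMatrix

variable [DecidableEq I]

theorem adjMatrix_self (i : I) : D.adjMatrix i i = 0 := by simp [adjMatrix, D.C_diag]

theorem adjMatrix_nonneg (i j : I) : 0 ≤ D.adjMatrix i j := by
  by_cases h : i = j
  · subst h; rw [adjMatrix_self]
  · have := D.C_nonpos i j h
    simp [adjMatrix, h, this]

theorem C_eq (i j : I) : D.C i j = (if i = j then 2 else 0) - D.adjMatrix i j := by
  simp [adjMatrix]

theorem adjMatrix_ne_zero_iff (i j : I) : D.adjMatrix i j ≠ 0 ↔ D.diagram.Adj i j := by
  rw [adj_iff]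
  by_cases h : i = j
  · subst h; simp [adjMatrix_self]
  · simp [adjMatrix, h]

end adjMatrix

/-! ### Chebyshev polynomials of the adjacency matrix -/

/-- Two solutions on `ℤ` of a second-order recurrence agree if they agree at `0` and `1`. -/
theorem eq_of_recurrence {M : Type*} [AddCommGroup M] (T : M → M) {f g : ℤ → M}
    (hf : ∀ u, f (u + 1) + f (u - 1) = T (f u)) (hg : ∀ u, g (u + 1) + g (u - 1) = T (g u))
    (h0 : f 0 = g 0) (h1 : f 1 = g 1) (u : ℤ) : f u = g u := by
  suffices h : f u = g u ∧ f (u + 1) = g (u + 1) from h.1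
  induction u using Int.induction_on with
  | zero => exact ⟨h0, by simpa using h1⟩
  | succ n ih =>
    refine ⟨ih.2, ?_⟩
    have a := hf (n + 1)
    have b := hg (n + 1)
    rw [ih.2, ← b, add_sub_cancel_right, ih.1] at a
    exact add_right_cancel a
  | pred n ih =>
    rw [sub_add_cancel]
    refine ⟨?_, ih.1⟩
    have a := hf (-n)
    have b := hg (-n)
    rw [ih.1, ← b, ih.2] at a
    exact add_left_cancel a

section cheb

variable [DecidableEq I]

/-- The value `U_{u-1}(A / 2)` of a Chebyshev polynomial of the second kind at half the
adjacency matrix `A`. -/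
noncomputable def cheb (u : ℤ) : Matrix I I ℤ :=
  Polynomial.aeval D.adjMatrix (Polynomial.Chebyshev.S ℤ (u - 1))

theorem cheb_zero : D.cheb 0 = 0 := by simp [cheb]

theorem cheb_one : D.cheb 1 = 1 := by simp [cheb]

theorem cheb_neg (u : ℤ) : D.cheb (-u) = -D.cheb u := by
  simp [cheb, Polynomial.Chebyshev.S_neg_sub_one]

theorem cheb_rec (u : ℤ) : D.cheb (u + 1) + D.cheb (u - 1) = D.adjMatrix * D.cheb u := by
  have h := Polynomial.Chebyshev.S_add_one ℤ (u - 1)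
  rw [cheb, cheb, cheb, show u + 1 - 1 = u - 1 + 1 by ring, h]
  simp

theorem cheb_mul_comm (u v : ℤ) : D.cheb u * D.cheb v = D.cheb v * D.cheb u := by
  rw [cheb, cheb, ← map_mul, ← map_mul, mul_comm]

theorem cheb_two : D.cheb 2 = D.adjMatrix := by
  have h := D.cheb_rec 1
  simpa [cheb_zero, cheb_one] using h

theorem cheb_rec' (u : ℤ) : D.cheb (u + 1) + D.cheb (u - 1) = D.cheb u * D.adjMatrix := by
  rw [cheb_rec, ← cheb_two, cheb_mul_comm]

theorem cheb_rec_apply (u : ℤ) (i j : I) :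
    D.cheb (u + 1) i j + D.cheb (u - 1) i j = ∑ k, D.adjMatrix i k * D.cheb u k j := by
  have := congrFun (congrFun (D.cheb_rec u) i) j
  rwa [Matrix.add_apply, Matrix.mul_apply] at this

theorem cheb_rec_apply' (u : ℤ) (i j : I) :
    D.cheb (u + 1) i j + D.cheb (u - 1) i j = ∑ k, D.cheb u i k * D.adjMatrix k j := by
  have := congrFun (congrFun (D.cheb_rec' u) i) j
  rwa [Matrix.add_apply, Matrix.mul_apply] at this

end cheb

/-! ### The coefficients of the inverse of the quantized Cartan matrix -/

section coefficients

open scoped RatFunc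

/-- The Laurent expansion at `0` of a rational function, as a ring homomorphism. -/
noncomputable def laurentExpansion (F : Type*) [Field F] : RatFunc F →+* LaurentSeries F :=
  algebraMap _ _

theorem laurentExpansion_C {F : Type*} [Field F] (c : F) :
    laurentExpansion F (RatFunc.C c) = HahnSeries.single 0 c := by
  rw [laurentExpansion, ← RatFunc.algebraMap_C, ← IsScalarTower.algebraMap_apply,
    Polynomial.algebraMap_hahnSeries_apply]
  simp [HahnSeries.C_apply]

theorem laurentExpansion_X {F : Type*} [Field F] :
    laurentExpansion F RatFunc.X = HahnSeries.single 1 1 :=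
  RatFunc.coe_X

variable [DecidableEq I]

theorem b_eq_coeff (i j : I) (u : ℤ) :
    D.b i j u = (laurentExpansion ℚ (D.tB⁻¹ i j)).coeff u := rfl

theorem laurentExpansion_tB (i k : I) : laurentExpansion ℚ (D.tB i k) =
    ((if i = k then HahnSeries.single 1 1 + HahnSeries.single (-1) 1 else 0)
      - HahnSeries.single 0 (D.adjMatrix i k : ℚ)) * HahnSeries.single 0 (D.d k)⁻¹ := by
  rw [tB, Matrix.mul_diagonal, map_mul, laurentExpansion_C, tCartan, map_sub,
    ← map_intCast (RatFunc.C : ℚ →+* RatFunc ℚ), laurentExpansion_C]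
  congr 2
  split_ifs
  · rw [map_add, map_inv₀, laurentExpansion_X, HahnSeries.inv_single, inv_one]
  · simp

theorem b_rec (i j : I) (u : ℤ) :
    D.b i j (u + 1) / D.d i + D.b i j (u - 1) / D.d i
      - ∑ k, D.adjMatrix i k * (D.b k j u / D.d k) = if i = j ∧ u = 0 then 1 else 0 := by
  have h : (D.tB * D.tB⁻¹) i j = (1 : Matrix I I (RatFunc ℚ)) i j :=
    congrFun (congrFun (Matrix.mul_nonsing_inv D.tB D.isUnit_det_tB) i) j
  have h2 := congrArg (fun f => (laurentExpansion ℚ f).coeff u) h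
  simp only [Matrix.mul_apply, map_sum, map_mul, laurentExpansion_tB, sub_mul,
    HahnSeries.coeff_sum, HahnSeries.coeff_sub, Finset.sum_sub_distrib, ite_mul,
    zero_mul, Finset.sum_ite_eq, Finset.mem_univ, if_true, add_mul, HahnSeries.coeff_add,
    HahnSeries.coeff_single_mul, mul_assoc, apply_ite (fun f : LaurentSeries ℚ => f.coeff u),
    HahnSeries.coeff_zero, Matrix.one_apply, ← b_eq_coeff, sub_zero, sub_neg_eq_add, one_mul,
    apply_ite (laurentExpansion ℚ), map_one, map_zero, HahnSeries.coeff_one] at h2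
  rw [ite_and]
  refine Eq.trans ?_ (h2.trans (by congr))
  simp only [div_eq_inv_mul]
  ring

theorem b_eq_zero_of_nonpos (i j : I) (u : ℤ) (hu : u ≤ 0) : D.b i j u = 0 := by
  -- There are finitely many entries, each a Laurent series, so their orders have a common lower
  -- bound.
  obtain ⟨N, hN⟩ : ∃ N : ℤ, ∀ i j, ∀ u < N, D.b i j u = 0 := by
    refine ⟨∑ p : I × I, -|(laurentExpansion ℚ (D.tB⁻¹ p.1 p.2)).order|, fun i j u h => ?_⟩
    rw [b_eq_coeff]
    refine HahnSeries.coeff_eq_zero_of_lt_order (h.trans_le ?_)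
    have := Finset.single_le_sum (f := fun p : I × I =>
      |(laurentExpansion ℚ (D.tB⁻¹ p.1 p.2)).order|) (fun _ _ => abs_nonneg _)
      (Finset.mem_univ (i, j))
    have h2 := neg_abs_le (laurentExpansion ℚ (D.tB⁻¹ i j)).order
    rw [Finset.sum_neg_distrib]
    simp only at this
    omega
  -- The recurrence at u - 1 determines the coefficient at u from the two preceding degrees; its
  -- source term sits at 0, so for u ≤ 0 it never enters.
  have key : ∀ n : ℕ, ∀ i j, ∀ u : ℤ, u ≤ 0 → u < N + n → D.b i j u = 0 := by
    intro n
    induction n with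
    | zero => intro i j u _ h; exact hN i j u (by simpa using h)
    | succ n ih =>
      intro i j u h0 h
      have h1 := D.b_rec i j (u - 1)
      rw [ih i j (u - 1 - 1) (by omega) (by push_cast at h; omega), Finset.sum_eq_zero,
        if_neg (by omega)] at h1
      · have := (D.d_pos i).ne'
        simpa [this] using h1
      · intro k _
        rw [ih k j (u - 1) (by omega) (by push_cast at h; omega)]
        simp
  exact key (u - N + 1).toNat i j u hu (by omega)

theorem b_eq_cheb (i j : I) (u : ℤ) (hu : 0 ≤ u) : D.b i j u = D.d i * D.cheb u i j := by
  obtain ⟨n, rfl⟩ := Int.eq_ofNat_of_zero_le hu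
  suffices h : (∀ i, D.b i j n = D.d i * D.cheb n i j) ∧
      ∀ i, D.b i j (n + 1) = D.d i * D.cheb (n + 1) i j from h.1 i
  have hrec : ∀ (u : ℤ) (i), D.b i j (u + 1) = D.d i * (∑ k, D.adjMatrix i k * (D.b k j u / D.d k)
      + if i = j ∧ u = 0 then 1 else 0) - D.b i j (u - 1) := by
    intro u i
    rw [← D.b_rec i j u]
    have := (D.d_pos i).ne'
    field_simp
    ring
  induction n with
  | zero =>
    refine ⟨fun i => by simp [b_eq_zero_of_nonpos, cheb_zero], fun i => ?_⟩
    have := hrec 0 i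
    simp only [b_eq_zero_of_nonpos _ _ _ _ le_rfl, D.b_eq_zero_of_nonpos _ _ (0 - 1) (by simp)]
      at this
    rw [Nat.cast_zero, this, zero_add, cheb_one, Matrix.one_apply]
    simp
  | succ n ih =>
    obtain ⟨ih1, ih2⟩ := ih (by positivity)
    push_cast
    refine ⟨ih2, fun i => ?_⟩
    have hc := D.cheb_rec_apply (n + 1) i j
    rw [← eq_sub_iff_add_eq] at hc
    rw [hrec, add_sub_cancel_right, ih1, if_neg (by omega), add_zero, hc, add_sub_cancel_right, Int.cast_sub, mul_sub]
    simp only [ih2]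
    push_cast
    congr 2
    exact Finset.sum_congr rfl fun k _ => by rw [mul_div_cancel_left₀ _ (D.d_pos k).ne']

/-- Both sides are odd in u, and only one of the two terms on the left can be nonzero. -/
theorem b_sub_b_neg (i j : I) (u : ℤ) :
    D.b i j u - D.b i j (-u) = D.d i * D.cheb u i j := by
  rcases le_total 0 u with h | h
  · rw [b_eq_cheb _ _ _ _ h, b_eq_zero_of_nonpos _ _ _ (-u) (by omega), sub_zero]
  · rw [b_eq_zero_of_nonpos _ _ _ _ h, b_eq_cheb _ _ _ (-u) (by omega), cheb_neg]
    simp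

end coefficients

/-! ### The root lattice and sign coherence of roots -/

/-- The element `∑ x_i α_i` of the root lattice. -/
noncomputable def rootSum : (I → ℤ) →ₗ[ℤ] P := Fintype.linearCombination ℤ D.α

theorem rootSum_apply (x : I → ℤ) : D.rootSum x = ∑ i, x i • D.α i :=
  Fintype.linearCombination_apply ℤ D.α x

theorem rootSum_injective : Function.Injective D.rootSum :=
  linearIndependent_iff_injective_fintypeLinearCombination.1 D.linearIndependent_α

theorem rootSum_single [DecidableEq I] (i : I) (n : ℤ) :
    D.rootSum (Pi.single i n) = n • D.α i :=
  Fintype.linearCombination_apply_single ℤ D.α i n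

theorem coroot_rootSum (i : I) (x : I → ℤ) : D.coroot i (D.rootSum x) = ∑ k, D.C i k * x k := by
  simp [rootSum_apply, D.coroot_α, mul_comm]

theorem form_rootSum_left (x : I → ℤ) (v : P) :
    D.form (D.rootSum x) v = ∑ i, x i * (D.d i * D.coroot i v) := by
  simp [rootSum_apply, form_α_eq]

theorem form_rootSum_pos {x : I → ℤ} (hx : x ≠ 0) : 0 < D.form (D.rootSum x) (D.rootSum x) := by
  have h := D.form_posDef (fun i => (x i : ℚ)) (fun h => hx (funext fun i => by
    simpa using congrFun h i))
  convert h using 1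
  rw [form_rootSum_left]
  refine Finset.sum_congr rfl fun i _ => ?_
  rw [coroot_rootSum]
  push_cast
  rw [Finset.mul_sum, Finset.mul_sum]
  refine Finset.sum_congr rfl fun j _ => ?_
  rw [form_α_α]
  ring

theorem even_sum_of_symm {ι : Type*} (s : Finset ι) (M : ι → ι → ℤ) (hM : ∀ i j, M i j = M j i)
    (hd : ∀ i, Even (M i i)) : Even (∑ i ∈ s, ∑ j ∈ s, M i j) := by
  classical
  induction s using Finset.induction_on with
  | empty => simp
  | insert a s ha ih =>
    rw [Finset.sum_insert ha, Finset.sum_insert ha]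
    simp only [Finset.sum_insert ha, Finset.sum_add_distrib]
    rw [Finset.sum_congr rfl (fun i _ => hM i a)]
    have : Even (∑ j ∈ s, M a j + ∑ j ∈ s, M a j) := ⟨_, rfl⟩
    have := ((hd a).add this).add ih
    refine (congrArg Even ?_).mp this
    ring

/-- If all `d_i x_i` are integral multiples of `c`, then the square length of `∑ x_i α_i` is an
integral multiple of `2 c`. -/
theorem exists_form_rootSum_eq {c : ℚ} {x : I → ℤ} (hx : ∀ i, ∃ n : ℤ, D.d i * x i = c * n) :
    ∃ n : ℤ, D.form (D.rootSum x) (D.rootSum x) = 2 * c * n := by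
  choose y hy using hx
  have hform : D.form (D.rootSum x) (D.rootSum x)
      = c * ((∑ i, ∑ j, y i * (D.C i j * x j) : ℤ) : ℚ) := by
    rw [form_rootSum_left]
    push_cast
    rw [Finset.mul_sum]
    refine Finset.sum_congr rfl fun i _ => ?_
    rw [coroot_rootSum, ← mul_assoc, mul_comm (x i : ℚ), hy, mul_assoc, ← Finset.mul_sum]
    push_cast
    rfl
  rcases eq_or_ne c 0 with rfl | hc
  · exact ⟨0, by simpa using hform⟩
  -- Since c y_i = d_i x_i, symmetry of y_i C_ij x_j is symmetrizability of C; the diagonal terms 2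
  -- y_i x_i are even.
  obtain ⟨n, hn⟩ := even_sum_of_symm Finset.univ (fun i j => y i * (D.C i j * x j)) (by
    intro i j
    have h1 := D.d_mul_C_comm i j
    have : (c : ℚ) * (y i * (D.C i j * x j)) = c * (y j * (D.C j i * x i)) := by
      linear_combination (x i * x j : ℚ) * h1 - (D.C i j * x j : ℚ) * hy i
        + (D.C j i * x i : ℚ) * hy j
    exact_mod_cast mul_left_cancel₀ hc this) (fun i => ⟨y i * x i, by rw [D.C_diag]; ring⟩)
  refine ⟨n, ?_⟩
  rw [hform, hn]
  push_cast
  ring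

theorem two_mul_le_form_rootSum {c : ℚ} (hc : 0 < c) {x : I → ℤ}
    (hx : ∀ i, ∃ n : ℤ, D.d i * x i = c * n) (h0 : x ≠ 0) :
    2 * c ≤ D.form (D.rootSum x) (D.rootSum x) := by
  obtain ⟨n, hn⟩ := D.exists_form_rootSum_eq hx
  have hpos := D.form_rootSum_pos h0
  rw [hn] at hpos ⊢
  have : (0 : ℚ) < n := by
    by_contra! h
    nlinarith [mul_nonneg hc.le (neg_nonneg.2 h)]
  have : (1 : ℚ) ≤ n := by exact_mod_cast this
  nlinarith

/-- A vector of square length `2 c` in the lattice of the `∑ x_i α_i` with `d_i x_i ∈ c ℤ` has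
coefficients of one sign. -/
theorem nonneg_or_nonpos_of_form_eq {c : ℚ} (hc : 0 < c) {x : I → ℤ}
    (hx : ∀ i, ∃ n : ℤ, D.d i * x i = c * n)
    (hn : D.form (D.rootSum x) (D.rootSum x) = 2 * c) : 0 ≤ x ∨ x ≤ 0 := by
  by_contra! h
  -- With mixed signs x = a - b, both parts are nonzero and lie in the same lattice, so each has
  -- square length at least 2c. Their supports are disjoint, so their inner product is at most 0 and
  -- x would have square length at least 4c.
  set a : I → ℤ := fun i => max (x i) 0 with ha
  set b : I → ℤ := fun i => max (-x i) 0 with hb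
  have hab : x = a - b := by
    ext i
    simp only [ha, hb, Pi.sub_apply]
    omega
  have ha0 : a ≠ 0 := by
    intro h0
    refine h.2 fun i => ?_
    have := congrFun h0 i
    simp only [ha, Pi.zero_apply] at this ⊢
    omega
  have hb0 : b ≠ 0 := by
    intro h0
    refine h.1 fun i => ?_
    have := congrFun h0 i
    simp only [hb, Pi.zero_apply] at this ⊢
    omega
  have hal : ∀ i, ∃ n : ℤ, D.d i * a i = c * n := by
    intro i
    rcases le_total (x i) 0 with h0 | h0
    · exact ⟨0, by simp [ha, h0]⟩
    · simpa [ha, h0] using hx i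
  have hbl : ∀ i, ∃ n : ℤ, D.d i * b i = c * n := by
    intro i
    rcases le_total (x i) 0 with h0 | h0
    · obtain ⟨n, h⟩ := hx i
      refine ⟨-n, ?_⟩
      rw [show b i = -x i by simp [hb, h0]]
      push_cast
      linarith
    · exact ⟨0, by simp [hb, h0]⟩
  have hcross : D.form (D.rootSum a) (D.rootSum b) ≤ 0 := by
    rw [form_rootSum_left]
    refine Finset.sum_nonpos fun i _ => ?_
    have h1 : a i * ∑ k, D.C i k * b k ≤ 0 := by
      rw [Finset.mul_sum]
      refine Finset.sum_nonpos fun k _ => ?_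
      by_cases hik : i = k
      · subst hik
        rcases le_total (x i) 0 with h0 | h0 <;> simp [ha, hb, h0]
      · exact mul_nonpos_of_nonneg_of_nonpos (le_max_right _ _)
          (mul_nonpos_of_nonpos_of_nonneg (D.C_nonpos i k hik) (le_max_right _ _))
    rw [coroot_rootSum, mul_left_comm]
    exact mul_nonpos_of_nonneg_of_nonpos (D.d_pos i).le (by exact_mod_cast h1)
  have h1 := D.two_mul_le_form_rootSum hc hal ha0
  have h2 := D.two_mul_le_form_rootSum hc hbl hb0
  have h3 := D.form_symm (D.rootSum a) (D.rootSum b)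
  rw [hab] at hn
  simp only [map_sub, LinearMap.sub_apply] at hn
  linarith

/-! ### Words in the simple reflections -/

theorem s_mul_s (i : I) : D.s i * D.s i = 1 := by
  ext x
  exact Module.involutive_reflection (D.coroot_self i) x

theorem s_α (i : I) : D.s i (D.α i) = -D.α i := by
  rw [s_apply, coroot_self]
  module

theorem wordProd_nil : D.wordProd [] = 1 := rfl

theorem wordProd_cons (i : I) (l : List I) : D.wordProd (i :: l) = D.s i * D.wordProd l := by
  simp [wordProd]

theorem wordProd_append (l l' : List I) :
    D.wordProd (l ++ l') = D.wordProd l * D.wordProd l' := by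
  simp [wordProd]

theorem wordProd_singleton (i : I) : D.wordProd [i] = D.s i := by simp [wordProd]

theorem wordProd_reverse (l : List I) : D.wordProd l.reverse = (D.wordProd l)⁻¹ := by
  induction l with
  | nil => simp [wordProd]
  | cons i l ih =>
    rw [List.reverse_cons, wordProd_append, D.wordProd_cons i l, wordProd_singleton, ih, mul_inv_rev,
      inv_eq_of_mul_eq_one_left (D.s_mul_s i)]

theorem wordProd_mem (l : List I) : D.wordProd l ∈ D.weylGroup := by
  refine Subgroup.list_prod_mem _ fun w hw => ?_
  obtain ⟨i, _, rfl⟩ := List.mem_map.1 hw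
  exact Subgroup.subset_closure ⟨i, rfl⟩

theorem exists_wordProd_eq {w : P ≃ₗ[ℤ] P} (hw : w ∈ D.weylGroup) : ∃ l, D.wordProd l = w := by
  induction hw using Subgroup.closure_induction with
  | mem x hx =>
    obtain ⟨i, rfl⟩ := hx
    exact ⟨[i], D.wordProd_singleton i⟩
  | one => exact ⟨[], rfl⟩
  | mul x y _ _ hx hy =>
    obtain ⟨⟨l, rfl⟩, ⟨l', rfl⟩⟩ := hx, hy
    exact ⟨l ++ l', D.wordProd_append l l'⟩
  | inv x _ hx =>
    obtain ⟨l, rfl⟩ := hx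
    exact ⟨l.reverse, D.wordProd_reverse l⟩

theorem form_s (i : I) (x y : P) : D.form (D.s i x) (D.s i y) = D.form x y := by
  rw [s_apply, s_apply]
  simp only [map_sub, map_zsmul, LinearMap.sub_apply, LinearMap.smul_apply, form_α_eq,
    D.form_symm x (D.α i), coroot_self, zsmul_eq_mul]
  push_cast
  ring

theorem form_wordProd (l : List I) (x y : P) :
    D.form (D.wordProd l x) (D.wordProd l y) = D.form x y := by
  induction l with
  | nil => rfl
  | cons i l ih => rw [wordProd_cons, LinearEquiv.mul_apply, LinearEquiv.mul_apply, form_s, ih]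

theorem s_rootSum [DecidableEq I] (i : I) (x : I → ℤ) :
    D.s i (D.rootSum x) = D.rootSum (x - Pi.single i (∑ k, D.C i k * x k)) := by
  rw [s_apply, coroot_rootSum, map_sub, rootSum_single]

/-- The divisibility condition says that the coroot of the root is also an integral combination of
simple coroots. It makes 2 d_j the minimal square length in the relevant lattice, for long and short
roots alike. -/
theorem exists_wordProd_α_eq (l : List I) (j : I) : ∃ x : I → ℤ,
    D.wordProd l (D.α j) = D.rootSum x ∧ ∀ i, ∃ n : ℤ, D.d i * x i = D.d j * n := by
  classical
  induction l with
  | nil =>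
    refine ⟨Pi.single j 1, by simp [rootSum_single, wordProd_nil], fun i => ?_⟩
    by_cases h : i = j
    · subst h; exact ⟨1, by simp⟩
    · exact ⟨0, by simp [h]⟩
  | cons i l ih =>
    obtain ⟨x, hx, hd⟩ := ih
    refine ⟨_, by rw [wordProd_cons, LinearEquiv.mul_apply, hx, s_rootSum], fun k => ?_⟩
    by_cases h : k = i
    · subst h
      choose y hy using hd
      refine ⟨y k - ∑ m, D.C m k * y m, ?_⟩
      simp only [Pi.sub_apply, Pi.single_eq_same]
      push_cast
      rw [mul_sub, mul_sub, hy, Finset.mul_sum, Finset.mul_sum]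
      congr 1
      refine Finset.sum_congr rfl fun m _ => ?_
      linear_combination (D.C m k : ℚ) * hy m + (x m : ℚ) * D.d_mul_C_comm k m
    · simpa [h] using hd k

theorem nonneg_or_nonpos_of_wordProd_α_eq {l : List I} {j : I} {x : I → ℤ}
    (h : D.wordProd l (D.α j) = D.rootSum x) : 0 ≤ x ∨ x ≤ 0 := by
  obtain ⟨y, hy, hd⟩ := D.exists_wordProd_α_eq l j
  obtain rfl : x = y := D.rootSum_injective (h.symm.trans hy)
  refine D.nonneg_or_nonpos_of_form_eq (D.d_pos j) hd ?_
  rw [← h, form_wordProd, form_α_α, D.C_diag]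
  push_cast
  ring

/-! ### Positive vectors and the length function -/

/-- `v` is a nonzero combination of the simple roots with nonnegative coefficients. -/
def IsPos (v : P) : Prop := ∃ x : I → ℤ, 0 ≤ x ∧ x ≠ 0 ∧ v = D.rootSum x

theorem isPos_α (i : I) : D.IsPos (D.α i) := by
  classical
  exact ⟨Pi.single i 1, by simp, by simp, by simp [rootSum_single]⟩

theorem isPos_wordProd_α_or (l : List I) (j : I) :
    D.IsPos (D.wordProd l (D.α j)) ∨ D.IsPos (-D.wordProd l (D.α j)) := by
  obtain ⟨x, hx, _⟩ := D.exists_wordProd_α_eq l j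
  have h0 : x ≠ 0 := by
    rintro rfl
    have := D.form_α_pos j
    rw [← D.form_wordProd l, hx] at this
    simp at this
  rcases D.nonneg_or_nonpos_of_wordProd_α_eq hx with h | h
  · exact Or.inl ⟨x, h, h0, hx⟩
  · exact Or.inr ⟨-x, neg_nonneg.2 h, neg_ne_zero.2 h0, by rw [hx, map_neg]⟩

theorem IsPos.not_neg {v : P} (h : D.IsPos v) : ¬D.IsPos (-v) := by
  rintro ⟨y, hy, _, h2⟩
  obtain ⟨x, hx, hx0, rfl⟩ := h
  rw [← map_neg] at h2
  have := D.rootSum_injective h2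
  subst this
  exact hx0 (le_antisymm (neg_nonneg.1 hy) hx)

/-- This is the conjugation w s_i w⁻¹ = s_{w α_i}; invariance of the form transports the coroot
along with the root. -/
theorem s_mul_wordProd {l : List I} {i m : I} (h : D.wordProd l (D.α i) = D.α m) :
    D.s m * D.wordProd l = D.wordProd l * D.s i := by
  ext x
  have hc : D.coroot m (D.wordProd l x) = D.coroot i x := by
    have : (D.coroot m (D.wordProd l x) : ℚ) = D.coroot i x := by
      rw [D.coroot_eq, D.coroot_eq, ← h, form_wordProd, form_wordProd]
    exact_mod_cast this
  simp only [LinearEquiv.mul_apply, s_apply, map_sub, map_zsmul, hc, h]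

/-- The reflection s_m changes only the coefficient of α_m, so a positive root that it makes
negative is a multiple of α_m. Applying w⁻¹ shows that the multiplier divides a coefficient equal to
1. -/
theorem eq_α_of_isPos_of_isPos_neg_s {l : List I} {i m : I}
    (h1 : D.IsPos (D.wordProd l (D.α i))) (h2 : D.IsPos (-D.s m (D.wordProd l (D.α i)))) :
    D.wordProd l (D.α i) = D.α m := by
  classical
  obtain ⟨x, hx, _, hx2⟩ := h1
  obtain ⟨y, hy, _, hy2⟩ := h2
  rw [hx2, s_rootSum, ← map_neg] at hy2
  have hxy := D.rootSum_injective hy2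
  have hxm : x = Pi.single m (x m) := by
    ext k
    by_cases hk : k = m
    · subst hk; simp
    · have h3 := congrFun hxy k
      have h4 := hx k
      have h5 := hy k
      simp only [hk, Pi.neg_apply, Pi.sub_apply, Pi.zero_apply, ne_eq, not_false_eq_true,
        Pi.single_eq_of_ne] at h3 h4 h5 ⊢
      omega
  rw [hxm, rootSum_single] at hx2
  obtain ⟨z, hz, _⟩ := D.exists_wordProd_α_eq l.reverse m
  have h6 : D.α i = x m • D.rootSum z := by
    rw [← hz, ← map_zsmul, ← hx2, wordProd_reverse]
    exact ((D.wordProd l).symm_apply_apply _).symm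
  rw [← one_smul ℤ (D.α i), ← rootSum_single, ← map_zsmul] at h6
  have h7 := congrFun (D.rootSum_injective h6) i
  rw [Pi.single_eq_same, Pi.smul_apply, smul_eq_mul] at h7
  have h8 : x m = 1 := Int.eq_one_of_mul_eq_one_right (hx m) h7.symm
  rw [hx2, h8, one_smul]

/-- The exchange condition. -/
theorem exists_wordProd_mul_s_eq {l : List I} {i : I} (h : D.IsPos (-D.wordProd l (D.α i))) :
    ∃ l' : List I, l'.length + 1 = l.length ∧ D.wordProd l * D.s i = D.wordProd l' := by
  induction l with
  | nil => exact absurd h (D.isPos_α i).not_neg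
  | cons m l ih =>
    rcases D.isPos_wordProd_α_or l i with h1 | h1
    · refine ⟨l, rfl, ?_⟩
      have := D.s_mul_wordProd (D.eq_α_of_isPos_of_isPos_neg_s h1 h)
      rw [wordProd_cons, this, mul_assoc, s_mul_s, mul_one]
    · obtain ⟨l', hl, h2⟩ := ih h1
      exact ⟨m :: l', by simp [hl], by rw [wordProd_cons, mul_assoc, h2, wordProd_cons]⟩

theorem length_wordProd_le (l : List I) : D.length (D.wordProd l) ≤ l.length :=
  Nat.sInf_le ⟨l, rfl, rfl⟩

theorem exists_reduced {w : P ≃ₗ[ℤ] P} (hw : w ∈ D.weylGroup) :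
    ∃ l : List I, l.length = D.length w ∧ D.wordProd l = w := by
  obtain ⟨l, hl⟩ := D.exists_wordProd_eq hw
  exact Nat.sInf_mem (s := {n | ∃ l : List I, l.length = n ∧ D.wordProd l = w}) ⟨_, l, rfl, hl⟩

theorem length_mul_s_of_neg {w : P ≃ₗ[ℤ] P} (hw : w ∈ D.weylGroup) {i : I}
    (h : D.IsPos (-w (D.α i))) : D.length (w * D.s i) + 1 = D.length w := by
  obtain ⟨l, hl, rfl⟩ := D.exists_reduced hw
  obtain ⟨l', hl', h'⟩ := D.exists_wordProd_mul_s_eq h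
  have h1 := D.length_wordProd_le l'
  obtain ⟨l'', hl'', h''⟩ := D.exists_reduced (D.wordProd_mem l')
  have h2 := D.length_wordProd_le (l'' ++ [i])
  rw [wordProd_append, h'', wordProd_singleton, ← h', mul_assoc, s_mul_s, mul_one,
    List.length_append, List.length_singleton] at h2
  rw [h']
  omega

theorem s_mem (i : I) : D.s i ∈ D.weylGroup := Subgroup.subset_closure ⟨i, rfl⟩

theorem length_mul_s_of_pos {w : P ≃ₗ[ℤ] P} (hw : w ∈ D.weylGroup) {i : I}
    (h : D.IsPos (w (D.α i))) : D.length (w * D.s i) = D.length w + 1 := by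
  have := D.length_mul_s_of_neg (mul_mem hw (D.s_mem i)) (i := i)
    (by rwa [LinearEquiv.mul_apply, s_α, map_neg, neg_neg])
  rw [mul_assoc, s_mul_s, mul_one] at this
  omega

theorem eq_one_of_forall_isPos {w : P ≃ₗ[ℤ] P} (hw : w ∈ D.weylGroup)
    (h : ∀ i, D.IsPos (w (D.α i))) : w = 1 := by
  obtain ⟨l, hl, rfl⟩ := D.exists_reduced hw
  rcases List.eq_nil_or_concat l with rfl | ⟨l', i, rfl⟩
  · rfl
  · exfalso
    have h1 := D.length_mul_s_of_pos hw (h i)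
    have h2 := D.length_wordProd_le l'
    rw [List.concat_eq_append, wordProd_append, wordProd_singleton, mul_assoc, s_mul_s,
      mul_one] at h1
    simp [wordProd_append, wordProd_singleton] at hl
    omega

/-- Membership in the Weyl group matters: the simple roots need not span P, even rationally. -/
theorem eq_one_of_forall_α {w : P ≃ₗ[ℤ] P} (hw : w ∈ D.weylGroup)
    (h : ∀ i, w (D.α i) = D.α i) : w = 1 :=
  D.eq_one_of_forall_isPos hw fun i => by rw [h]; exact D.isPos_α i

theorem mul_self_eq_one_of_forall_α {w₀ : P ≃ₗ[ℤ] P} (hw₀ : w₀ ∈ D.weylGroup) {σ : I → I}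
    (hσ : ∀ i, w₀ (D.α i) = -D.α (σ i)) : w₀ * w₀ = 1 := by
  refine D.eq_one_of_forall_isPos (mul_mem hw₀ hw₀) fun i => ?_
  rw [LinearEquiv.mul_apply, hσ, map_neg, hσ, neg_neg]
  exact D.isPos_α _

theorem IsPos.neg_apply {w₀ : P ≃ₗ[ℤ] P} {σ : I → I} (hσ : ∀ i, w₀ (D.α i) = -D.α (σ i))
    {v : P} (hv : D.IsPos v) : D.IsPos (-w₀ v) := by
  classical
  obtain ⟨x, hx, h0, rfl⟩ := hv
  have h1 : -w₀ (D.rootSum x) = D.rootSum (∑ i, Pi.single (σ i) (x i)) := by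
    simp only [rootSum_apply D x, map_sum, map_zsmul, hσ, rootSum_single]
    simp
  refine ⟨_, Finset.sum_nonneg fun i _ => Pi.single_nonneg.2 (hx i), fun h => ?_, h1⟩
  rw [h, map_zero, neg_eq_zero, LinearEquiv.map_eq_zero_iff,
    map_eq_zero_iff _ D.rootSum_injective] at h1
  exact h0 h1

/-- An element of the Weyl group that permutes the simple roots up to sign `-1` is the unique
longest element. -/
theorem isLongest_iff {w₀ : P ≃ₗ[ℤ] P} (hw₀ : w₀ ∈ D.weylGroup) {σ : I → I}
    (hσ : ∀ i, w₀ (D.α i) = -D.α (σ i)) (w : P ≃ₗ[ℤ] P) : D.IsLongest w ↔ w = w₀ := by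
  -- Since -w₀ preserves positivity, a simple reflection that lengthens v on the right shortens w₀
  -- v.
  have key : ∀ n, ∀ v ∈ D.weylGroup, D.length v = n →
      D.length (w₀ * v) + D.length v = D.length w₀ := by
    intro n
    induction n with
    | zero =>
      intro v hv hn
      obtain ⟨l, hl, rfl⟩ := D.exists_reduced hv
      rw [hn, List.length_eq_zero_iff] at hl
      subst hl
      rw [hn, wordProd_nil, mul_one, add_zero]
    | succ n ih =>
      intro v hv hn
      obtain ⟨l, hl, rfl⟩ := D.exists_reduced hv
      rcases List.eq_nil_or_concat l with rfl | ⟨l', i, rfl⟩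
      · rw [hn] at hl
        simp at hl
      · rw [List.concat_eq_append] at hl hn ⊢
        have hl' := D.length_wordProd_le l'
        have hlen : l'.length = n := by simpa [hn] using hl
        rw [wordProd_append, wordProd_singleton] at hn ⊢
        rcases D.isPos_wordProd_α_or l' i with h | h
        · have h1 := D.length_mul_s_of_pos (D.wordProd_mem l') h
          have h2 := D.length_mul_s_of_neg (mul_mem hw₀ (D.wordProd_mem l'))
            (IsPos.neg_apply D hσ h)
          have h3 := ih _ (D.wordProd_mem l') (by omega)
          rw [mul_assoc] at h2
          omega
        · have h1 := D.length_mul_s_of_neg (D.wordProd_mem l') h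
          omega
  constructor
  · rintro ⟨hw, hmax⟩
    have h1 := key _ w hw rfl
    have h2 := hmax w₀ hw₀
    obtain ⟨l, hl, h3⟩ := D.exists_reduced (mul_mem hw₀ hw)
    rw [show D.length (w₀ * w) = 0 by omega, List.length_eq_zero_iff] at hl
    subst hl
    exact mul_left_cancel (h3.symm.trans (D.mul_self_eq_one_of_forall_α hw₀ hσ).symm)
  · rintro rfl
    exact ⟨hw₀, fun v hv => by have := key _ v hv rfl; omega⟩

/-! ### Height functions -/

/-- Every nonempty set of vertices of the Dynkin diagram contains a vertex with at most one
neighbour in the set. -/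
theorem exists_leaf {J : Finset I} (hJ : J.Nonempty) :
    ∃ i ∈ J, ∀ a ∈ J, ∀ b ∈ J, D.diagram.Adj i a → D.diagram.Adj i b → a = b := by
  classical
  by_contra! h
  -- If every vertex of J had two neighbours in J, the indicator vector of J would have nonpositive
  -- square length.
  set x : I → ℤ := fun i => if i ∈ J then 1 else 0 with hx
  have hx0 : x ≠ 0 := by
    obtain ⟨i, hi⟩ := hJ
    intro h0
    have := congrFun h0 i
    simp [hx, hi] at this
  have hpos := D.form_rootSum_pos hx0
  refine hpos.not_ge ?_
  rw [form_rootSum_left]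
  refine Finset.sum_nonpos fun i _ => ?_
  by_cases hi : i ∈ J
  · obtain ⟨a, ha, b, hb, hia, hib, hab⟩ := h i hi
    rw [adj_iff] at hia hib
    have h1 : ∑ k, D.C i k * x k ≤ 0 := by
      have h2 : ∑ k, D.C i k * x k = ∑ k ∈ J, D.C i k := by simp [hx]
      have h3 : ∑ k ∈ J, D.C i k ≤ ∑ k ∈ ({i, a, b} : Finset I), D.C i k := by
        refine Finset.sum_le_sum_of_subset_of_nonpos' ?_ fun k _ hk => ?_
        · intro k hk
          simp only [Finset.mem_insert, Finset.mem_singleton] at hk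
          rcases hk with rfl | rfl | rfl <;> assumption
        · simp only [Finset.mem_insert, not_or] at hk
          exact D.C_nonpos i k (Ne.symm hk.1)
      rw [Finset.sum_insert (by simp [hia.1, hib.1]), Finset.sum_insert (by simpa using hab),
        Finset.sum_singleton, D.C_diag] at h3
      have := D.C_nonpos i a hia.1
      have := D.C_nonpos i b hib.1
      omega
    rw [coroot_rootSum, show x i = 1 by simp [hx, hi], Int.cast_one, one_mul]
    exact mul_nonpos_of_nonneg_of_nonpos (D.d_pos i).le (by exact_mod_cast h1)
  · simp [hx, hi]

/-- Every orientation of the Dynkin diagram that is induced by a ranking of the vertices comes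
from a height function. -/
theorem exists_height_of_rank (r : I → ℕ) :
    ∃ ξ : I → ℤ, ∀ i j, D.diagram.Adj i j → r i < r j → ξ i = ξ j + 1 := by
  classical
  suffices h : ∀ J : Finset I, ∃ ξ : I → ℤ, ∀ i ∈ J, ∀ j ∈ J,
      D.diagram.Adj i j → r i < r j → ξ i = ξ j + 1 by
    obtain ⟨ξ, hξ⟩ := h Finset.univ
    exact ⟨ξ, fun i j => hξ i (Finset.mem_univ _) j (Finset.mem_univ _)⟩
  intro J
  induction J using Finset.strongInduction with
  | H J ih =>
    rcases J.eq_empty_or_nonempty with rfl | hJ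
    · exact ⟨0, by simp⟩
    -- A vertex with at most one neighbour is removed and later put back at a height dictated by
    -- that neighbour alone, so no consistency condition arises.
    obtain ⟨v, hv, hleaf⟩ := D.exists_leaf hJ
    obtain ⟨ξ, hξ⟩ := ih (J.erase v) (Finset.erase_ssubset hv)
    by_cases hn : ∃ a ∈ J, D.diagram.Adj v a
    · obtain ⟨a, ha, hva⟩ := hn
      refine ⟨Function.update ξ v (if r v < r a then ξ a + 1 else ξ a - 1), ?_⟩
      intro i hi j hj hij hr
      by_cases hiv : i = v
      · subst hiv
        obtain rfl := hleaf a ha j hj hva hij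
        simp [hij.ne', hr]
      · by_cases hjv : j = v
        · subst hjv
          obtain rfl := hleaf a ha i hi hva hij.symm
          simp [hij.ne, hr.not_gt]
        · simpa [hiv, hjv] using hξ i (by simp [hi, hiv]) j (by simp [hj, hjv]) hij hr
    · push Not at hn
      refine ⟨ξ, fun i hi j hj hij hr => ?_⟩
      have hiv : i ≠ v := by rintro rfl; exact hn j hj hij
      have hjv : j ≠ v := by rintro rfl; exact hn i hi hij.symm
      exact hξ i (by simp [hi, hiv]) j (by simp [hj, hjv]) hij hr

theorem exists_isHeightFunction_of_rank {r : I → ℕ} (hr : Function.Injective r) :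
    ∃ ξ : I → ℤ, D.IsHeightFunction ξ ∧ ∀ i j, D.diagram.Adj i j → r i < r j → ξ j < ξ i := by
  obtain ⟨ξ, hξ⟩ := D.exists_height_of_rank r
  refine ⟨ξ, fun i j hij => ?_, fun i j hij h => by have := hξ i j hij h; omega⟩
  rcases lt_or_gt_of_ne (hr.ne hij.ne) with h | h
  · rw [hξ i j hij h]; simp
  · rw [hξ j i hij.symm h]; simp

theorem exists_isHeightFunction : ∃ ξ : I → ℤ, D.IsHeightFunction ξ := by
  obtain ⟨ξ, h, _⟩ := D.exists_isHeightFunction_of_rank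
    (r := fun i => (Fintype.equivFin I i : ℕ))
    (Fin.val_injective.comp (Fintype.equivFin I).injective)
  exact ⟨ξ, h⟩

variable {D} in
theorem IsHeightFunction.eq_or {ξ : I → ℤ} (hξ : D.IsHeightFunction ξ) {i j : I}
    (h : D.diagram.Adj i j) : ξ i = ξ j + 1 ∨ ξ i = ξ j - 1 := by
  have := hξ i j h
  rcases abs_eq (zero_le_one' ℤ) |>.1 this with h | h <;> omega

theorem diagram_connected : D.diagram.Connected := D.connected

variable {D} in
theorem IsHeightFunction.even_dist {ξ : I → ℤ} (hξ : D.IsHeightFunction ξ) (i j : I) :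
    Even (D.diagram.dist i j + ξ i - ξ j) := by
  obtain ⟨p, hp⟩ := (D.diagram_connected i j).exists_walk_length_eq_dist
  rw [← hp]
  clear hp
  induction p with
  | nil => simp
  | cons h p ih =>
    rw [SimpleGraph.Walk.length_cons]
    push_cast
    rcases hξ.eq_or h with h | h <;> rw [h] <;> grind

/-! ### Parity vanishing of the Chebyshev values -/

section parity

variable [DecidableEq I]

variable {D} in
-- Heights change parity along each edge and A is supported on edges, so the recurrence preserves
-- the checkerboard pattern of the initial values.
theorem IsHeightFunction.cheb_eq_zero {ξ : I → ℤ} (hξ : D.IsHeightFunction ξ) (j : I) (u : ℤ) :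
    ∀ i, ¬Even (u + ξ i + ξ j + 1) → D.cheb u i j = 0 := by
  have key : ∀ u : ℤ, (∀ i, ¬Even (u + ξ i + ξ j + 1) → D.cheb u i j = 0) →
      ∀ i, Even (u + ξ i + ξ j + 1) → D.cheb (u + 1) i j + D.cheb (u - 1) i j = 0 := by
    intro u h i hi
    rw [cheb_rec_apply]
    refine Finset.sum_eq_zero fun k _ => ?_
    by_cases hik : D.adjMatrix i k = 0
    · rw [hik, zero_mul]
    · rw [h k, mul_zero]
      rw [← ne_eq, adjMatrix_ne_zero_iff] at hik
      rcases hξ.eq_or hik with h | h <;> rw [h] at hi <;> grind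
  suffices h : (∀ i, ¬Even (u + ξ i + ξ j + 1) → D.cheb u i j = 0) ∧
      ∀ i, ¬Even (u + 1 + ξ i + ξ j + 1) → D.cheb (u + 1) i j = 0 from h.1
  induction u using Int.induction_on with
  | zero =>
    refine ⟨by simp [cheb_zero], fun i hi => ?_⟩
    rw [zero_add, cheb_one, Matrix.one_apply_ne]
    rintro rfl
    grind
  | succ n ih =>
    refine ⟨ih.2, fun i hi => ?_⟩
    have := key (n + 1) ih.2 i (by grind)
    rw [add_sub_cancel_right, ih.1 i (by grind), add_zero] at this
    exact this
  | pred n ih =>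
    refine ⟨fun i hi => ?_, by simpa using ih.1⟩
    have := key (-n) ih.1 i (by grind)
    rw [ih.2 i (by grind), zero_add] at this
    exact this

/-! ### Products of commuting reflections -/

theorem wordProd_rootSum_of_not_adj {l : List I} (hl : l.Nodup)
    (h : ∀ a ∈ l, ∀ b ∈ l, ¬D.diagram.Adj a b) (x : I → ℤ) :
    D.wordProd l (D.rootSum x) =
      D.rootSum fun i => if i ∈ l then ∑ k, D.adjMatrix i k * x k - x i else x i := by
  induction l with
  | nil => simp [wordProd_nil]
  | cons a l ih =>
    rw [List.nodup_cons] at hl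
    rw [wordProd_cons, LinearEquiv.mul_apply,
      ih hl.2 fun b hb c hc => h b (by simp [hb]) c (by simp [hc]), s_rootSum]
    congr 1
    ext i
    by_cases hi : i = a
    · subst hi
      simp only [Pi.sub_apply, hl.1, if_false, Pi.single_eq_same, List.mem_cons_self, if_true]
      have h1 : ∀ k, D.C i k * (if k ∈ l then ∑ m, D.adjMatrix k m * x m - x k else x k)
          = (if i = k then 2 * x k else 0) - D.adjMatrix i k * x k := by
        intro k
        rw [C_eq]
        by_cases hk : k ∈ l
        · have hik : i ≠ k := by rintro rfl; exact hl.1 hk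
          have : D.adjMatrix i k = 0 := by
            by_contra h0
            exact h i (by simp) k (by simp [hk]) ((D.adjMatrix_ne_zero_iff i k).1 h0)
          simp [hik, this]
        · simp only [hk, if_false]
          split_ifs <;> ring
      rw [Finset.sum_congr rfl fun k _ => h1 k, Finset.sum_sub_distrib]
      simp
      ring
    · simp [hi]

/-- The list of the vertices of the Dynkin diagram whose height has the same parity as `a`. -/
noncomputable def parityClass (ξ : I → ℤ) (a : ℤ) : List I :=
  (Finset.univ.filter fun i => Even (ξ i + a)).toList

/-- The sum of two consecutive values of `cheb` in column `j`, which turns out to be the vector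
of coefficients of a root. -/
noncomputable def chebCol (u : ℤ) (j : I) : I → ℤ := fun i => D.cheb u i j + D.cheb (u + 1) i j

variable {D} in
-- At a reflected vertex the recurrence turns the coefficient into `cheb (u - 1) + cheb (u + 2)`;
-- parity kills the first term there, as well as `cheb (u + 1)`. At the other vertices `cheb u` and
-- `cheb (u + 2)` vanish, and both sides are `cheb (u + 1)`.
theorem IsHeightFunction.wordProd_parityClass {ξ : I → ℤ} (hξ : D.IsHeightFunction ξ)
    (u a : ℤ) (j : I) (ha : Even (a + u + ξ j + 1)) :
    D.wordProd (parityClass ξ a) (D.rootSum (D.chebCol u j)) =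
      D.rootSum (D.chebCol (u + 1) j) := by
  rw [wordProd_rootSum_of_not_adj]
  · congr 1
    ext i
    have h1 := D.cheb_rec_apply u i j
    have h2 := D.cheb_rec_apply (u + 1) i j
    rw [add_sub_cancel_right] at h2
    simp only [parityClass, Finset.mem_toList, Finset.mem_filter, Finset.mem_univ, true_and,
      chebCol, mul_add, Finset.sum_add_distrib, ← h1, ← h2]
    split_ifs with hi
    · rw [hξ.cheb_eq_zero j (u + 1) i (by grind), hξ.cheb_eq_zero j (u - 1) i (by grind)]
      ring
    · rw [hξ.cheb_eq_zero j u i (by grind), hξ.cheb_eq_zero j (u + 1 + 1) i (by grind)]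
      ring
  · exact Finset.nodup_toList _
  · intro a ha b hb hab
    simp only [parityClass, Finset.mem_toList, Finset.mem_filter, Finset.mem_univ, true_and]
      at ha hb
    rcases hξ.eq_or hab with h | h <;> grind

theorem chebCol_zero (j : I) : D.chebCol 0 j = Pi.single j 1 := by
  ext i
  simp [chebCol, cheb_zero, cheb_one, Matrix.one_apply, Pi.single_apply]

theorem nonneg_or_nonpos_chebCol (n : ℕ) (j : I) : 0 ≤ D.chebCol n j ∨ D.chebCol n j ≤ 0 := by
  obtain ⟨ξ, hξ⟩ := D.exists_isHeightFunction
  suffices h : ∃ l, D.wordProd l (D.α j) = D.rootSum (D.chebCol n j) by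
    obtain ⟨l, hl⟩ := h
    exact D.nonneg_or_nonpos_of_wordProd_α_eq hl
  induction n with
  | zero => exact ⟨[], by simp [chebCol_zero, rootSum_single, wordProd_nil]⟩
  | succ n ih =>
    obtain ⟨l, hl⟩ := ih
    refine ⟨parityClass ξ (n + ξ j + 1) ++ l, ?_⟩
    rw [wordProd_append, LinearEquiv.mul_apply, hl, hξ.wordProd_parityClass _ _ _ (by grind)]
    push_cast
    rfl

/-! ### The first zero of the Chebyshev values -/

theorem cheb_succ_nonneg {n : ℕ} {j : I} (h : ∀ i, 0 ≤ D.cheb n i j) (h0 : ∃ i, D.cheb n i j ≠ 0)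
    (i : I) : 0 ≤ D.cheb (n + 1) i j := by
  obtain ⟨ξ, hξ⟩ := D.exists_isHeightFunction
  have hpar : ∀ i, D.cheb n i j = 0 ∨ D.cheb (n + 1) i j = 0 := by
    intro i
    by_cases he : Even ((n : ℤ) + ξ i + ξ j + 1)
    · exact Or.inr (hξ.cheb_eq_zero j _ i (by grind))
    · exact Or.inl (hξ.cheb_eq_zero j _ i he)
  rcases D.nonneg_or_nonpos_chebCol n j with hc | hc
  · have := hc i
    simp only [chebCol, Pi.zero_apply] at this
    rcases hpar i with h1 | h1 <;> omega
  · obtain ⟨k, hk⟩ := h0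
    have h1 := hc k
    have h2 := h k
    simp only [chebCol, Pi.zero_apply] at h1
    rcases hpar k with h3 | h3 <;> omega

theorem exists_nonneg_vecMul_C_eq_one :
    ∃ v : I → ℚ, (∀ i, 0 ≤ v i) ∧ ∀ k, ∑ i, v i * D.C i k = 1 := by
  let G : Matrix I I ℚ := fun i k => D.form (D.α i) (D.α k)
  have hG : ∀ x : I → ℚ, x ≠ 0 → 0 < ∑ i, x i * ∑ k, G i k * x k := by
    intro x hx
    convert D.form_posDef x hx using 2 with i
    rw [Finset.mul_sum]
    exact Finset.sum_congr rfl fun k _ => by simp only [G]; ring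
  have hinj : Function.Injective G.mulVec := by
    rw [← Matrix.coe_mulVecLin, ← LinearMap.ker_eq_bot, LinearMap.ker_eq_bot']
    intro x hx
    by_contra h0
    have h1 := hG x h0
    have h2 : ∀ i, ∑ k, G i k * x k = 0 := fun i => congrFun hx i
    simp [h2] at h1
  obtain ⟨y, hy⟩ := Matrix.mulVec_surjective_iff_isUnit.2
    (Matrix.mulVec_injective_iff_isUnit.1 hinj) (fun _ => 1)
  have hy : ∀ i, ∑ k, G i k * y k = 1 := fun i => congrFun hy i
  have hy0 : ∀ i, 0 ≤ y i := by
    by_contra! hneg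
    obtain ⟨i₀, hi₀⟩ := hneg
    -- Test against the negative part b of y. Here b and y + b have disjoint supports and G has
    -- nonpositive off-diagonal entries, so bᵀG(y + b) ≤ 0, although bᵀGy ≥ 0 and bᵀGb > 0.
    set b : I → ℚ := fun i => max (-y i) 0 with hb
    have hb0 : ∀ i, 0 ≤ b i := fun i => le_max_right _ _
    have h1 := hG b (fun h => by
      have := congrFun h i₀
      simp only [hb, Pi.zero_apply] at this
      linarith [le_max_left (-y i₀) 0])
    have h2 : 0 ≤ ∑ i, b i * ∑ k, G i k * y k :=
      Finset.sum_nonneg fun i _ => by rw [hy, mul_one]; exact hb0 i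
    have h3 : ∑ i, b i * ∑ k, G i k * (y k + b k) ≤ 0 := by
      refine Finset.sum_nonpos fun i _ => ?_
      rw [Finset.mul_sum]
      refine Finset.sum_nonpos fun k _ => ?_
      have hyb : 0 ≤ y k + b k := by linarith [le_max_left (-y k) 0]
      by_cases hik : i = k
      · subst hik
        have : b i * (y i + b i) = 0 := by
          rcases le_total (y i) 0 with h | h <;> simp [hb, h]
        rw [mul_left_comm, this, mul_zero]
      · refine mul_nonpos_of_nonneg_of_nonpos (hb0 i)
          (mul_nonpos_of_nonpos_of_nonneg ?_ hyb)
        simp only [G]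
        rw [form_α_α]
        exact mul_nonpos_of_nonneg_of_nonpos (D.d_pos i).le
          (by exact_mod_cast D.C_nonpos i k hik)
    simp only [mul_add, Finset.sum_add_distrib] at h3
    linarith
  refine ⟨fun i => D.d i * y i, fun i => mul_nonneg (D.d_pos i).le (hy0 i), fun k => ?_⟩
  rw [← hy k]
  refine Finset.sum_congr rfl fun i _ => ?_
  simp only [G]
  rw [form_α_α, D.d_mul_C_comm]
  ring

theorem exists_cheb_col_eq_zero (j : I) : ∃ n : ℕ, 0 < n ∧ ∀ i, D.cheb n i j = 0 := by
  by_contra! h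
  have hnn : ∀ n : ℕ, ∀ i, 0 ≤ D.cheb n i j := by
    intro n
    induction n with
    | zero => simp [cheb_zero]
    | succ n ih =>
      rcases Nat.eq_zero_or_pos n with rfl | hn
      · intro i
        rw [zero_add, Nat.cast_one, cheb_one, Matrix.one_apply]
        split_ifs <;> simp
      · exact_mod_cast D.cheb_succ_nonneg ih (h n hn)
  obtain ⟨v, hv, hvC⟩ := D.exists_nonneg_vecMul_C_eq_one
  set a : ℕ → ℚ := fun n => ∑ i, v i * D.cheb n i j with ha
  have ha0 : ∀ n, 0 ≤ a n := fun n =>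
    Finset.sum_nonneg fun i _ => mul_nonneg (hv i) (by exact_mod_cast hnn n i)
  have hvA : ∀ k, ∑ i, v i * D.adjMatrix i k = 2 * v k - 1 := by
    intro k
    have h1 := hvC k
    simp only [C_eq] at h1
    push_cast at h1
    simp only [mul_sub, Finset.sum_sub_distrib, mul_ite, mul_zero, Finset.sum_ite_eq',
      Finset.mem_univ, if_true] at h1
    linarith
  -- From vA = 2v - 1, the deficit is the sum of the entries of a nonzero nonnegative integer
  -- column, hence at least 1.
  have hstep : ∀ n, a (n + 2) + a n ≤ 2 * a (n + 1) - 1 := by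
    intro n
    have h1 : a (n + 2) + a n = ∑ i, v i * ∑ k, (D.adjMatrix i k : ℚ) * D.cheb (n + 1) k j := by
      simp only [ha]
      rw [← Finset.sum_add_distrib]
      refine Finset.sum_congr rfl fun i _ => ?_
      have := D.cheb_rec_apply (n + 1) i j
      rw [add_sub_cancel_right] at this
      rw [← mul_add]
      push_cast
      rw [show (n : ℤ) + 2 = n + 1 + 1 by ring]
      congr 1
      exact_mod_cast this
    have h2 : ∑ i, v i * ∑ k, D.adjMatrix i k * (D.cheb (n + 1) k j : ℚ)
        = ∑ k, (2 * v k - 1) * D.cheb (n + 1) k j := by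
      simp only [Finset.mul_sum, ← hvA, Finset.sum_mul]
      rw [Finset.sum_comm]
      simp only [mul_assoc]
    have h3 : (1 : ℚ) ≤ ∑ k, (D.cheb (n + 1) k j : ℚ) := by
      obtain ⟨k, hk⟩ := h (n + 1) (by omega)
      have h4 : ∀ k, 0 ≤ D.cheb (n + 1) k j := fun k => by exact_mod_cast hnn (n + 1) k
      have h5 := Finset.single_le_sum (f := fun k => D.cheb (n + 1) k j) (fun k _ => h4 k)
        (Finset.mem_univ k)
      have h6 := h4 k
      push_cast at hk
      exact_mod_cast (by omega : (1 : ℤ) ≤ ∑ k, D.cheb (n + 1) k j)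
    rw [h1, h2]
    simp only [sub_mul, Finset.sum_sub_distrib, one_mul, ha, mul_assoc, ← Finset.mul_sum]
    push_cast
    linarith
  have hdiff : ∀ n : ℕ, a (n + 1) - a n ≤ a 1 - n := by
    intro n
    induction n with
    | zero => simp [ha0 0]
    | succ n ih =>
      have := hstep n
      push_cast
      rw [show n + 1 + 1 = n + 2 from rfl]
      linarith
  obtain ⟨N, hN⟩ := exists_nat_ge (a 1 + 1)
  have hdec : ∀ k : ℕ, a (N + k) ≤ a N - k := by
    intro k
    induction k with
    | zero => simp
    | succ k ih =>
      have := hdiff (N + k)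
      push_cast at this ⊢
      rw [← add_assoc]
      have : (0 : ℚ) ≤ k := by positivity
      linarith
  obtain ⟨k, hk⟩ := exists_nat_gt (a N)
  linarith [hdec k, ha0 (N + k)]

/-- The values of the Chebyshev polynomials are nonnegative up to their first zero. -/
theorem exists_first_zero_cheb : ∃ m : ℕ, 1 < m ∧ D.cheb m = 0 ∧
    (∀ n : ℕ, 0 < n → n < m → D.cheb n ≠ 0) ∧
    ∀ n : ℕ, n ≤ m → ∀ i j, 0 ≤ D.cheb n i j := by
  classical
  obtain ⟨j₀⟩ := D.diagram_connected.nonempty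
  have hex : ∃ n : ℕ, 0 < n ∧ ∃ j, ∀ i, D.cheb n i j = 0 := by
    obtain ⟨n, hn, h⟩ := D.exists_cheb_col_eq_zero j₀
    exact ⟨n, hn, j₀, h⟩
  obtain ⟨hm0, j₁, hm⟩ := Nat.find_spec hex
  have hmin : ∀ n : ℕ, 0 < n → n < Nat.find hex → ∀ j, ∃ i, D.cheb n i j ≠ 0 := by
    intro n hn hlt j
    have := Nat.find_min hex hlt
    push Not at this
    exact this hn j
  generalize Nat.find hex = m at hm0 hm hmin
  have hnn : ∀ n : ℕ, n ≤ m → ∀ i j, 0 ≤ D.cheb n i j := by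
    intro n
    induction n with
    | zero => simp [cheb_zero]
    | succ n ih =>
      intro hn i j
      rcases Nat.eq_zero_or_pos n with rfl | hn0
      · rw [zero_add, Nat.cast_one, cheb_one, Matrix.one_apply]
        split_ifs <;> simp
      · exact_mod_cast D.cheb_succ_nonneg (fun i => ih (by omega) i j) (hmin n hn0 hn j) i
  -- Since A commutes with `cheb m`, a zero column j gives Σ_k `cheb m i k` A_kj = 0, a sum of
  -- nonnegative terms.
  have hstep : ∀ j k, D.diagram.Adj j k → (∀ i, D.cheb m i j = 0) → ∀ i, D.cheb m i k = 0 := by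
    intro j k hjk h i
    have h1 := D.cheb_rec_apply m i j
    rw [cheb_rec_apply'] at h1
    simp only [h, mul_zero, Finset.sum_const_zero] at h1
    have h2 := (Finset.sum_eq_zero_iff_of_nonneg fun k _ =>
      mul_nonneg (hnn m le_rfl i k) (D.adjMatrix_nonneg k j)).1 h1 k (Finset.mem_univ k)
    exact (mul_eq_zero.1 h2).resolve_right ((D.adjMatrix_ne_zero_iff k j).2 hjk.symm)
  have hzero : ∀ k, ∀ i, D.cheb m i k = 0 := by
    intro k
    obtain ⟨p⟩ := D.diagram_connected j₁ k
    induction p with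
    | nil => exact hm
    | cons h p ih => exact ih (hstep _ _ h hm)
  refine ⟨m, ?_, ?_, ?_, hnn⟩
  · rcases Nat.lt_or_ge 1 m with h | h
    · exact h
    · obtain rfl : m = 1 := by omega
      have := hzero j₀ j₀
      simp [cheb_one] at this
  · ext i k
    exact hzero k i
  · intro n hn hlt h0
    obtain ⟨i, hi⟩ := hmin n hn hlt j₀
    exact hi (by rw [h0]; rfl)

/-- Nonnegativity forbids cancellation, so each product contributing to an off-diagonal entry of M²
vanishes separately. -/
theorem exists_perm_of_nonneg_of_mul_self_eq_one {M : Matrix I I ℤ} (h0 : ∀ i j, 0 ≤ M i j)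
    (h1 : M * M = 1) : ∃ σ : I → I, ∀ i j, M i j = if i = σ j then 1 else 0 := by
  have hmul : ∀ i j, ∑ k, M i k * M k j = if i = j then 1 else 0 := fun i j => by
    rw [← Matrix.mul_apply, h1, Matrix.one_apply]
  have hex : ∀ j, ∃ k, M j k * M k j ≠ 0 := by
    intro j
    by_contra! h
    have := hmul j j
    simp [h] at this
  choose σ hσ using hex
  have hne : ∀ i j, i ≠ σ j → M i j = 0 := by
    intro i j hij
    have h2 := hmul i (σ j)
    rw [if_neg hij, Finset.sum_eq_zero_iff_of_nonneg
      fun k _ => mul_nonneg (h0 _ _) (h0 _ _)] at h2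
    exact (mul_eq_zero.1 (h2 j (Finset.mem_univ j))).resolve_right (left_ne_zero_of_mul (hσ j))
  refine ⟨σ, fun i j => ?_⟩
  split_ifs with h
  · subst h
    have h2 := hmul j j
    rw [if_pos rfl, Finset.sum_eq_single (σ j) (fun k _ hk => by rw [hne k j hk, mul_zero])
      (by simp)] at h2
    exact Int.eq_one_of_mul_eq_one_left (h0 _ _) h2
  · exact hne i j h

/-! ### The period of the Chebyshev values -/

section period

variable {D} {m : ℕ}

/-- Both sides solve the same recurrence in u; they agree at 0 because `cheb m` vanishes, and at 1
by the recurrence at m. -/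
theorem cheb_add_eq_neg_cheb_sub (hm : D.cheb m = 0) (u : ℤ) :
    D.cheb (m + u) = -D.cheb (m - u) := by
  refine eq_of_recurrence (fun M => D.adjMatrix * M) (f := fun u => D.cheb (m + u))
    (g := fun u => -D.cheb (m - u)) (fun u => ?_) (fun u => ?_) ?_ ?_ u
  · rw [← cheb_rec, add_assoc, add_sub_assoc]
  · rw [mul_neg, ← cheb_rec, neg_add_rev]
    congr 3 <;> ring
  · simp [hm]
  · have := D.cheb_rec m
    rw [hm, mul_zero] at this
    exact eq_neg_of_add_eq_zero_left this

theorem cheb_sub_eq_mul (hm : D.cheb m = 0) (u : ℤ) :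
    D.cheb (m - u) = D.cheb u * D.cheb (m - 1) := by
  refine eq_of_recurrence (fun M => D.adjMatrix * M) (f := fun u => D.cheb (m - u))
    (g := fun u => D.cheb u * D.cheb (m - 1)) (fun u => ?_) (fun u => ?_) ?_ ?_ u
  · rw [← cheb_rec, add_comm]
    congr 2 <;> ring
  · rw [← add_mul, cheb_rec, mul_assoc]
  · simp [hm, cheb_zero]
  · simp [cheb_one]

theorem cheb_add_two_mul (hm : D.cheb m = 0) (u : ℤ) : D.cheb (u + 2 * m) = D.cheb u := by
  have h := cheb_add_eq_neg_cheb_sub hm (u + m)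
  rw [show (m : ℤ) - (u + m) = -u by ring, cheb_neg, neg_neg] at h
  rw [← h]
  congr 1
  ring

theorem exists_star (hm : D.cheb m = 0) (h0 : ∀ i j, 0 ≤ D.cheb (m - 1) i j) :
    ∃ σ : I → I, ∀ i j, D.cheb (m - 1) i j = if i = σ j then 1 else 0 := by
  refine exists_perm_of_nonneg_of_mul_self_eq_one h0 ?_
  rw [← cheb_sub_eq_mul hm, sub_sub_cancel, cheb_one]

theorem cheb_sub_apply (hm : D.cheb m = 0) {σ : I → I}
    (hσ : ∀ i j, D.cheb (m - 1) i j = if i = σ j then 1 else 0) (u : ℤ) (i j : I) :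
    D.cheb (m - u) i j = D.cheb u i (σ j) := by
  rw [cheb_sub_eq_mul hm, Matrix.mul_apply]
  simp [hσ]

/-- The alternating product of the two halves of a bipartite Coxeter element, with `m` factors,
maps each simple root to the negative of a simple root. -/
theorem exists_mem_weylGroup_α_eq_neg (hm : D.cheb m = 0) {σ : I → I}
    (hσ : ∀ i j, D.cheb (m - 1) i j = if i = σ j then 1 else 0) :
    ∃ w ∈ D.weylGroup, ∀ j, w (D.α j) = -D.α (σ j) := by
  obtain ⟨ξ, hξ⟩ := D.exists_isHeightFunction
  -- One word must serve all j. Since α_j is both `chebCol 0 j` and minus `chebCol (-1) j`, starting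
  -- the even vertices one step behind lets the same parity class advance both families.
  have key : ∀ q : ℕ, ∃ l, ∀ j,
      (Odd (ξ j) → D.wordProd l (D.α j) = D.rootSum (D.chebCol q j)) ∧
      (Even (ξ j) → D.wordProd l (D.α j) = -D.rootSum (D.chebCol (q - 1) j)) := by
    intro q
    induction q with
    | zero =>
      refine ⟨[], fun j => ⟨fun _ => ?_, fun _ => ?_⟩⟩
      · simp [chebCol_zero, rootSum_single, wordProd_nil]
      · have : D.chebCol (-1) j = -Pi.single j 1 := by
          ext i
          simp [chebCol, cheb_zero, cheb_neg, cheb_one, Matrix.one_apply, Pi.single_apply]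
        simp [this, rootSum_single, wordProd_nil]
    | succ q ih =>
      obtain ⟨l, hl⟩ := ih
      refine ⟨parityClass ξ q ++ l, fun j => ⟨fun h => ?_, fun h => ?_⟩⟩
      · rw [wordProd_append, LinearEquiv.mul_apply, (hl j).1 h,
          hξ.wordProd_parityClass _ _ _ (by grind)]
        push_cast
        rfl
      · rw [wordProd_append, LinearEquiv.mul_apply, (hl j).2 h, map_neg,
          hξ.wordProd_parityClass _ _ _ (by grind)]
        push_cast
        rw [sub_add_cancel, add_sub_cancel_right]
  obtain ⟨l, hl⟩ := key m
  refine ⟨_, D.wordProd_mem l, fun j => ?_⟩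
  have h1 : D.cheb (m + 1) = -D.cheb (m - 1) := cheb_add_eq_neg_cheb_sub hm 1
  rcases Int.even_or_odd (ξ j) with h | h
  · have : D.chebCol (m - 1) j = Pi.single (σ j) 1 := by
      ext i
      simp [chebCol, hm, hσ, Pi.single_apply]
    rw [(hl j).2 h, this, rootSum_single, one_smul]
  · have : D.chebCol m j = -Pi.single (σ j) 1 := by
      ext i
      simp [chebCol, hm, hσ, Pi.single_apply, h1]
    rw [(hl j).1 h, this, map_neg, rootSum_single, one_smul]

end period

end parity

/-! ### The vectors `γ_j` of a Coxeter element -/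

theorem s_eq_self {i : I} {x : P} (h : D.coroot i x = 0) : D.s i x = x := by
  rw [s_apply, h, zero_smul, sub_zero]

theorem wordProd_eq_self {l : List I} {x : P} (h : ∀ i ∈ l, D.coroot i x = 0) :
    D.wordProd l x = x := by
  induction l with
  | nil => rfl
  | cons i l ih =>
    rw [wordProd_cons, LinearEquiv.mul_apply, ih fun k hk => h k (by simp [hk]),
      D.s_eq_self (h i (by simp))]

theorem wordProd_ϖ_of_notMem {l : List I} {j : I} (h : j ∉ l) :
    D.wordProd l (D.ϖ j) = D.ϖ j :=
  D.wordProd_eq_self fun i hi => D.coroot_ϖ_ne j i (by rintro rfl; exact h hi)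

theorem sub_wordProd_mem_range (l : List I) (x : P) :
    x - D.wordProd l x ∈ LinearMap.range D.rootSum := by
  classical
  induction l with
  | nil => simp [wordProd_nil]
  | cons i l ih =>
    have h : x - D.wordProd (i :: l) x = (x - D.wordProd l x)
        + D.rootSum (Pi.single i (D.coroot i (D.wordProd l x))) := by
      rw [wordProd_cons, LinearEquiv.mul_apply, s_apply, rootSum_single]
      abel
    rw [h]
    exact add_mem ih ⟨_, rfl⟩

theorem α_sub_wordProd_α (l : List I) (j : I) :
    D.α j - D.wordProd l (D.α j) = ∑ k, D.C k j • D.γ (D.wordProd l) k := by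
  -- The difference is killed by every simple coroot, hence fixed by the Weyl group; it need not
  -- vanish.
  set z := D.α j - ∑ k, D.C k j • D.ϖ k with hz
  have hz0 : D.wordProd l z = z := by
    refine D.wordProd_eq_self fun i _ => ?_
    rw [hz, map_sub, map_sum, D.coroot_α, Finset.sum_eq_single i]
    · simp [D.coroot_ϖ_self]
    · intro k _ hk
      simp [D.coroot_ϖ_ne k i hk]
    · simp
  have hα : D.α j = z + ∑ k, D.C k j • D.ϖ k := by rw [hz, sub_add_cancel]
  rw [hα, map_add, hz0, add_sub_add_left_eq_sub, map_sum, ← Finset.sum_sub_distrib]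
  exact Finset.sum_congr rfl fun k _ => by rw [map_zsmul, γ, smul_sub]

theorem exists_abs_lt {I : Type*} [Fintype I] (ξ : I → ℤ) : ∃ M : ℤ, ∀ j, |ξ j| < M := by
  refine ⟨∑ j, |ξ j| + 1, fun j => ?_⟩
  have := Finset.single_le_sum (f := fun j => |ξ j|) (fun j _ => abs_nonneg _)
    (Finset.mem_univ j)
  exact Int.lt_add_one_of_le this

/-- The vector `τ ^ k γ_j` placed at the vertex `(j, p)`, `p = ξ_j - 2 k`, of the repetition
quiver, extended by zero to all integers `p`. -/
noncomputable def repetition (ξ : I → ℤ) (τ : P ≃ₗ[ℤ] P) (D : FiniteCartanDatum I P) (j : I)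
    (p : ℤ) : P :=
  if Even (ξ j - p) then (τ ^ ((ξ j - p) / 2)) (D.γ τ j) else 0

variable {D} in
theorem repetition_two_mul {ξ : I → ℤ} {τ : P ≃ₗ[ℤ] P} (j : I) (p k : ℤ) (h : ξ j = p + 2 * k) :
    repetition ξ τ D j p = (τ ^ k) (D.γ τ j) := by
  rw [repetition, if_pos (by grind)]
  congr 2
  omega

variable [DecidableEq I]

theorem form_ϖ_rootSum (l : I) (x : I → ℤ) :
    D.form (D.ϖ l) (D.rootSum x) = x l * D.d l := by
  simp [rootSum_apply, form_ϖ_α]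

theorem eq_of_forall_form_ϖ_eq {x y : P} (hx : x ∈ LinearMap.range D.rootSum)
    (hy : y ∈ LinearMap.range D.rootSum) (h : ∀ l, D.form (D.ϖ l) x = D.form (D.ϖ l) y) :
    x = y := by
  obtain ⟨a, rfl⟩ := hx
  obtain ⟨b, rfl⟩ := hy
  congr 1
  ext l
  have := h l
  rw [form_ϖ_rootSum, form_ϖ_rootSum] at this
  exact_mod_cast mul_right_cancel₀ (D.d_pos l).ne' this

/-- Here γ_j is the image of α_j under the prefix before j. Letters of the prefix have the same γ
for the prefix as for the whole word, and all other letters have γ = 0 for the prefix. -/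
theorem γ_wordProd {l₁ l₂ : List I} {j : I} (hl : (l₁ ++ j :: l₂).Nodup) :
    D.γ (D.wordProd (l₁ ++ j :: l₂)) j = D.α j +
      ∑ k, (if k ∈ l₁ then D.adjMatrix k j else 0) • D.γ (D.wordProd (l₁ ++ j :: l₂)) k := by
  rw [List.nodup_append, List.nodup_cons] at hl
  obtain ⟨-, ⟨hj2, -⟩, hdisj⟩ := hl
  have hj1 : j ∉ l₁ := fun h => hdisj j h j (by simp) rfl
  have h1 : D.γ (D.wordProd (l₁ ++ j :: l₂)) j = D.wordProd l₁ (D.α j) := by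
    rw [γ, wordProd_append, wordProd_cons, LinearEquiv.mul_apply, LinearEquiv.mul_apply,
      D.wordProd_ϖ_of_notMem hj2, s_apply, D.coroot_ϖ_self, one_smul, map_sub,
      D.wordProd_ϖ_of_notMem hj1, sub_sub_cancel]
  rw [h1, ← sub_eq_iff_eq_add', ← neg_sub, α_sub_wordProd_α, ← Finset.sum_neg_distrib]
  refine Finset.sum_congr rfl fun k _ => ?_
  split_ifs with hk
  · have hkj : k ≠ j := by rintro rfl; exact hj1 hk
    have hk2 : k ∉ j :: l₂ := fun h => hdisj k hk k h rfl
    rw [γ, γ, wordProd_append, LinearEquiv.mul_apply, D.wordProd_ϖ_of_notMem hk2, C_eq,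
      if_neg hkj, zero_sub, neg_smul, neg_neg]
  · rw [γ, D.wordProd_ϖ_of_notMem hk, sub_self, smul_zero, zero_smul, neg_zero]

/-! ### Adapted words -/

theorem isAdapted_iff {ξ : I → ℤ} {l : List I} (hl : l.Nodup) : D.IsAdapted ξ l ↔
    ∀ l₁ j l₂, l = l₁ ++ j :: l₂ → ∀ k, D.diagram.Adj j k →
      ξ k - (if k ∈ l₁ then 2 else 0) < ξ j := by
  induction l generalizing ξ with
  | nil => simp [IsAdapted]
  | cons a l ih =>
    rw [List.nodup_cons] at hl
    rw [IsAdapted, ih hl.2]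
    have hr : ∀ c ∈ l, reflect a ξ c = ξ c := by
      intro c hc
      have : a ≠ c := by rintro rfl; exact hl.1 hc
      simp [reflect, this]
    have hr2 : ∀ l₁ c l₂, l = l₁ ++ c :: l₂ → ∀ k, reflect a ξ k - (if k ∈ l₁ then 2 else 0)
        = ξ k - (if k ∈ a :: l₁ then 2 else 0) := by
      rintro l₁ c l₂ rfl k
      by_cases hk : k = a
      · subst hk
        have : k ∉ l₁ := fun h => hl.1 (by simp [h])
        simp [reflect, this]
      · simp [reflect, hk, Ne.symm hk]
    constructor
    · rintro ⟨h1, h2⟩ l₁ j l₂ hl' k hk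
      rcases l₁ with _ | ⟨a', l₁⟩
      · simp only [List.nil_append, List.cons.injEq] at hl'
        obtain ⟨rfl, rfl⟩ := hl'
        simpa using h1 k hk
      · simp only [List.cons_append, List.cons.injEq] at hl'
        obtain ⟨rfl, hl'⟩ := hl'
        rw [← hr2 l₁ j l₂ hl', ← hr j (by simp [hl'])]
        exact h2 l₁ j l₂ hl' k hk
    · refine fun h => ⟨fun k hk => by simpa using h [] a l rfl k hk, ?_⟩
      intro l₁ j l₂ hl' k hk
      rw [hr2 l₁ j l₂ hl', hr j (by simp [hl'])]
      exact h (a :: l₁) j l₂ (by rw [hl', List.cons_append]) k hk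

variable {D} in
theorem IsAdapted.mem_iff {ξ : I → ℤ} {l₁ l₂ : List I} {j k : I}
    (h : D.IsAdapted ξ (l₁ ++ j :: l₂)) (hl : (l₁ ++ j :: l₂).Nodup)
    (hjk : D.diagram.Adj j k) : k ∈ l₁ ↔ ξ j < ξ k := by
  rw [isAdapted_iff D hl] at h
  constructor
  · intro hk
    obtain ⟨a, b, rfl⟩ := List.append_of_mem hk
    have h1 := h a k (b ++ j :: l₂) (by simp) j hjk.symm
    have hj : j ∉ a := by
      intro hj
      rw [List.nodup_append] at hl
      exact hl.2.2 j (by simp [hj]) j (by simp) rfl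
    simpa [hj] using h1
  · intro hlt
    by_contra hk
    have h1 := h l₁ j l₂ rfl k hjk
    simp only [hk, if_false] at h1
    omega

section coxeter

variable {D} {ξ : I → ℤ} {τ : P ≃ₗ[ℤ] P}

theorem IsCoxeterElementOf.mem_weylGroup (hτ : D.IsCoxeterElementOf ξ τ) : τ ∈ D.weylGroup := by
  obtain ⟨l, -, -, -, rfl⟩ := hτ
  exact D.wordProd_mem l

theorem IsCoxeterElementOf.γ_eq (hτ : D.IsCoxeterElementOf ξ τ)
    (j : I) : D.γ τ j = D.α j + ∑ k, (if ξ j < ξ k then D.adjMatrix k j else 0) • D.γ τ k := by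
  obtain ⟨l, hnd, hmem, had, rfl⟩ := hτ
  obtain ⟨l₁, l₂, rfl⟩ := List.append_of_mem (hmem j)
  rw [D.γ_wordProd hnd]
  congr 1
  refine Finset.sum_congr rfl fun k _ => ?_
  congr 1
  by_cases hk : D.adjMatrix k j = 0
  · simp [hk]
  · have hjk := ((D.adjMatrix_ne_zero_iff k j).1 hk).symm
    simp only [had.mem_iff hnd hjk]

theorem IsCoxeterElementOf.apply_α (hτ : D.IsCoxeterElementOf ξ τ)
    (j : I) :
    D.γ τ j = -τ (D.α j) + ∑ k, (if ξ j < ξ k then 0 else D.adjMatrix k j) • D.γ τ k := by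
  have h1 := hτ.γ_eq j
  have h2 : D.α j - τ (D.α j) = ∑ k, D.C k j • D.γ τ k := by
    obtain ⟨l, -, -, -, rfl⟩ := hτ
    exact D.α_sub_wordProd_α l j
  have h3 : ∑ k, D.C k j • D.γ τ k = (2 : ℤ) • D.γ τ j
      - (∑ k, (if ξ j < ξ k then D.adjMatrix k j else 0) • D.γ τ k
        + ∑ k, (if ξ j < ξ k then 0 else D.adjMatrix k j) • D.γ τ k) := by
    rw [← Finset.sum_add_distrib]
    have : (2 : ℤ) • D.γ τ j = ∑ k, (if k = j then (2 : ℤ) else 0) • D.γ τ k := by simp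
    rw [this, ← Finset.sum_sub_distrib]
    refine Finset.sum_congr rfl fun k _ => ?_
    rw [C_eq, ← add_smul, ← sub_smul]
    congr 2
    split_ifs <;> simp
  rw [h3] at h2
  generalize ∑ k, (if ξ j < ξ k then D.adjMatrix k j else 0) • D.γ τ k = S₁ at *
  generalize ∑ k, (if ξ j < ξ k then 0 else D.adjMatrix k j) • D.γ τ k = S₂ at *
  have h4 : τ (D.α j) = D.α j - ((2 : ℤ) • D.γ τ j - (S₁ + S₂)) := by rw [← h2]; abel
  rw [h4, two_smul]
  nth_rw 1 [h1]
  rw [h1]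
  abel

/-- Apply τ to the expansion of γ_j over higher neighbours and add the expansion over lower ones:
the terms ±τ α_j cancel. -/
theorem IsCoxeterElementOf.γ_add_apply_γ (hτ : D.IsCoxeterElementOf ξ τ) (j : I) :
    D.γ τ j + τ (D.γ τ j) =
      ∑ k, D.adjMatrix k j • (if ξ j < ξ k then τ (D.γ τ k) else D.γ τ k) := by
  have h2 := congrArg τ (hτ.γ_eq j)
  rw [map_add, map_sum] at h2
  have h1 := hτ.apply_α j
  rw [eq_neg_add_iff_add_eq, add_comm] at h1
  rw [h2, ← add_assoc, h1, ← Finset.sum_add_distrib]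
  refine Finset.sum_congr rfl fun k _ => ?_
  split_ifs <;> simp

/-- The mesh relations. -/
theorem IsCoxeterElementOf.repetition_mesh (hτ : D.IsCoxeterElementOf ξ τ)
    (hξ : D.IsHeightFunction ξ) (j : I) (p : ℤ) :
    repetition ξ τ D j (p + 1) + repetition ξ τ D j (p - 1) =
      ∑ k, D.adjMatrix k j • repetition ξ τ D k p := by
  rcases Int.even_or_odd' (ξ j - p - 1) with ⟨q, hq | hq⟩
  · rw [repetition_two_mul j (p + 1) q (by omega), repetition_two_mul j (p - 1) (q + 1) (by omega),
      zpow_add_one, LinearEquiv.mul_apply, ← map_add, hτ.γ_add_apply_γ, map_sum]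
    refine Finset.sum_congr rfl fun k _ => ?_
    rw [map_zsmul]
    by_cases hk : D.adjMatrix k j = 0
    · simp [hk]
    congr 1
    rcases hξ.eq_or ((D.adjMatrix_ne_zero_iff k j).1 hk) with h | h
    · rw [if_pos (by omega), repetition_two_mul k p (q + 1) (by omega), zpow_add_one,
        LinearEquiv.mul_apply]
    · rw [if_neg (by omega), repetition_two_mul k p q (by omega)]
  · rw [repetition, repetition, if_neg (by grind), if_neg (by grind), add_zero,
      Finset.sum_eq_zero]
    intro k _
    by_cases hk : D.adjMatrix k j = 0
    · simp [hk]
    rw [repetition, if_neg, smul_zero]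
    rcases hξ.eq_or ((D.adjMatrix_ne_zero_iff k j).1 hk) with h | h <;> grind

theorem IsCoxeterElementOf.form_ϖ_γ (hτ : D.IsCoxeterElementOf ξ τ) (l j : I)
    (hlj : ξ l ≤ ξ j) : D.form (D.ϖ l) (D.γ τ j) = if l = j then D.d l else 0 := by
  obtain ⟨M, hM⟩ := exists_abs_lt ξ
  suffices h : ∀ n : ℕ, ∀ j, M - n < ξ j → ξ l ≤ ξ j →
      D.form (D.ϖ l) (D.γ τ j) = if l = j then D.d l else 0 from
    h (M - ξ j + 1).toNat j (by omega) hlj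
  intro n
  induction n with
  | zero =>
    intro j hj
    have := hM j
    have := le_abs_self (ξ j)
    push_cast at hj
    omega
  | succ n ih =>
    intro j hj hlj
    rw [hτ.γ_eq, map_add, map_sum, form_ϖ_α, Finset.sum_eq_zero, add_zero]
    intro k _
    split_ifs with hk
    · rw [map_zsmul, ih k (by push_cast at hj; omega) (by omega), if_neg (by rintro rfl; omega),
        smul_zero]
    · simp

theorem IsCoxeterElementOf.form_ϖ_inv_γ (hτ : D.IsCoxeterElementOf ξ τ)
    (hξ : D.IsHeightFunction ξ) (l j : I) (hlj : ξ j < ξ l) :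
    D.form (D.ϖ l) ((τ ^ (-1 : ℤ)) (D.γ τ j)) = 0 := by
  obtain ⟨M, hM⟩ := exists_abs_lt ξ
  suffices h : ∀ n : ℕ, ∀ j, ξ j < -M + n → ξ j < ξ l →
      D.form (D.ϖ l) ((τ ^ (-1 : ℤ)) (D.γ τ j)) = 0 from
    h (M + ξ j + 1).toNat j (by omega) hlj
  intro n
  induction n with
  | zero =>
    intro j hj
    have := hM j
    have := neg_abs_le (ξ j)
    push_cast at hj
    omega
  | succ n ih =>
    intro j hj hlj
    have h1 : (τ ^ (-1 : ℤ)) (τ (D.α j)) = D.α j := by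
      rw [zpow_neg_one]
      exact τ.symm_apply_apply _
    rw [hτ.apply_α, map_add, map_neg, h1, map_add, map_neg, form_ϖ_α,
      if_neg (by rintro rfl; omega), neg_zero, zero_add, map_sum, map_sum, Finset.sum_eq_zero]
    intro k _
    split_ifs with hk
    · simp
    · by_cases hA : D.adjMatrix k j = 0
      · simp [hA]
      · have := hξ.eq_or ((D.adjMatrix_ne_zero_iff k j).1 hA)
        rw [map_zsmul, map_zsmul, ih k (by push_cast at hj; omega) (by omega), smul_zero]

theorem IsCoxeterElementOf.form_ϖ_mesh (hτ : D.IsCoxeterElementOf ξ τ)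
    (hξ : D.IsHeightFunction ξ) (l j : I) (p : ℤ) :
    D.form (D.ϖ l) (repetition ξ τ D j (p + 1)) + D.form (D.ϖ l) (repetition ξ τ D j (p - 1)) =
      ∑ k, D.adjMatrix k j * D.form (D.ϖ l) (repetition ξ τ D k p) := by
  rw [← map_add, hτ.repetition_mesh hξ, map_sum]
  simp

/-- Together with `form_ϖ_repetition_of_lt` this supplies the initial rows at p = ξ l + 1 and p = ξ
l. The mesh relations propagate downward from above all heights here, and upward from below all
heights there. -/
theorem IsCoxeterElementOf.form_ϖ_repetition_of_le (hτ : D.IsCoxeterElementOf ξ τ)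
    (hξ : D.IsHeightFunction ξ) (l j : I) (p : ℤ) (hp : ξ l ≤ p) (hj : p ≤ ξ j) :
    D.form (D.ϖ l) (repetition ξ τ D j p) = if l = j then D.d l else 0 := by
  obtain ⟨M, hM⟩ := exists_abs_lt ξ
  suffices h : ∀ n : ℕ, ∀ p, M - n < p → ξ l ≤ p → ∀ j, p ≤ ξ j →
      D.form (D.ϖ l) (repetition ξ τ D j p) = if l = j then D.d l else 0 from
    h (M - p + 1).toNat p (by omega) hp j hj
  intro n
  induction n with
  | zero =>
    intro p hp _ j hj
    have := hM j
    have := le_abs_self (ξ j)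
    push_cast at hp
    omega
  | succ n ih =>
    intro p hn hp j hj
    push_cast at hn
    rcases eq_or_ne (ξ j) p with h | h
    · rw [repetition_two_mul j p 0 (by omega), zpow_zero]
      exact hτ.form_ϖ_γ l j (by omega)
    rw [if_neg (by rintro rfl; omega)]
    rcases eq_or_ne (ξ j) (p + 1) with h' | h'
    · rw [repetition, if_neg (by grind), map_zero]
    have h1 := hτ.form_ϖ_mesh hξ l j (p + 1)
    rw [add_sub_cancel_right, ih (p + 1 + 1) (by omega) (by omega) j (by omega),
      if_neg (by rintro rfl; omega), zero_add] at h1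
    rw [h1, Finset.sum_eq_zero]
    intro k _
    by_cases hA : D.adjMatrix k j = 0
    · simp [hA]
    have := hξ.eq_or ((D.adjMatrix_ne_zero_iff k j).1 hA)
    rw [ih (p + 1) (by omega) (by omega) k (by omega), if_neg (by rintro rfl; omega), mul_zero]

theorem IsCoxeterElementOf.form_ϖ_repetition_of_lt (hτ : D.IsCoxeterElementOf ξ τ)
    (hξ : D.IsHeightFunction ξ) (l j : I) (p : ℤ) (hp : p ≤ ξ l + 1) (hj : ξ j < p) :
    D.form (D.ϖ l) (repetition ξ τ D j p) = 0 := by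
  obtain ⟨M, hM⟩ := exists_abs_lt ξ
  suffices h : ∀ n : ℕ, ∀ p, p < -M + n → p ≤ ξ l + 1 → ∀ j, ξ j < p →
      D.form (D.ϖ l) (repetition ξ τ D j p) = 0 from
    h (M + p + 1).toNat p (by omega) hp j hj
  intro n
  induction n with
  | zero =>
    intro p hp _ j hj
    have := hM j
    have := neg_abs_le (ξ j)
    push_cast at hp
    omega
  | succ n ih =>
    intro p hn hp j hj
    push_cast at hn
    rcases eq_or_ne p (ξ j + 1) with h | h
    · rw [repetition, if_neg (by grind), map_zero]
    rcases eq_or_ne p (ξ j + 2) with h' | h'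
    · rw [repetition_two_mul j p (-1) (by omega)]
      exact hτ.form_ϖ_inv_γ hξ l j (by omega)
    have h1 := hτ.form_ϖ_mesh hξ l j (p - 1)
    rw [sub_add_cancel, ih (p - 1 - 1) (by omega) (by omega) j (by omega), add_zero] at h1
    rw [h1, Finset.sum_eq_zero]
    intro k _
    by_cases hA : D.adjMatrix k j = 0
    · simp [hA]
    have := hξ.eq_or ((D.adjMatrix_ne_zero_iff k j).1 hA)
    rw [ih (p - 1) (by omega) (by omega) k (by omega), mul_zero]

/-- The pairing of `ϖ_l` with `τ ^ k γ_j` is given by Chebyshev polynomials. -/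
theorem IsCoxeterElementOf.form_ϖ_repetition (hτ : D.IsCoxeterElementOf ξ τ)
    (hξ : D.IsHeightFunction ξ) (l j : I) (u : ℤ) :
    D.form (D.ϖ l) (repetition ξ τ D j (ξ l + 1 - u)) = D.d l * D.cheb u l j := by
  refine congrFun (eq_of_recurrence (fun (x : I → ℚ) j => ∑ k, D.adjMatrix k j * x k)
    (f := fun u j => D.form (D.ϖ l) (repetition ξ τ D j (ξ l + 1 - u)))
    (g := fun u j => D.d l * D.cheb u l j) (fun u => ?_) (fun u => ?_) ?_ ?_ u) j
  · ext j
    simp only [Pi.add_apply]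
    rw [← hτ.form_ϖ_mesh hξ, add_comm, show ξ l + 1 - (u + 1) = ξ l + 1 - u - 1 by ring,
      show ξ l + 1 - (u - 1) = ξ l + 1 - u + 1 by ring]
  · ext j
    have := D.cheb_rec_apply' u l j
    simp only [Pi.add_apply]
    rw [← mul_add, ← Int.cast_add, this]
    push_cast
    rw [Finset.mul_sum]
    exact Finset.sum_congr rfl fun k _ => by ring
  · ext j
    simp only [cheb_zero, sub_zero, Matrix.zero_apply, Int.cast_zero, mul_zero]
    rcases lt_or_ge (ξ l) (ξ j) with h | h
    · rw [hτ.form_ϖ_repetition_of_le hξ l j _ (by omega) (by omega),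
        if_neg (by rintro rfl; omega)]
    · exact hτ.form_ϖ_repetition_of_lt hξ l j _ le_rfl (by omega)
  · ext j
    simp only [cheb_one, add_sub_cancel_right, Matrix.one_apply]
    rcases le_or_gt (ξ l) (ξ j) with h | h
    · rw [hτ.form_ϖ_repetition_of_le hξ l j _ le_rfl h]
      split_ifs <;> simp
    · rw [hτ.form_ϖ_repetition_of_lt hξ l j _ (by omega) h, if_neg (by rintro rfl; omega)]
      simp

/-! ### The Coxeter number -/

/-- The period 2m of `cheb` becomes m for τ, because one application of τ moves p by 2. Pairings
with fundamental weights separate points of the root lattice, so τ^m fixes each γ_j and hence each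
α_j. -/
theorem IsCoxeterElementOf.pow_eq_one (hτ : D.IsCoxeterElementOf ξ τ)
    (hξ : D.IsHeightFunction ξ) {m : ℕ} (hm : D.cheb m = 0) : τ ^ m = 1 := by
  obtain ⟨w, hw⟩ := D.exists_wordProd_eq (pow_mem hτ.mem_weylGroup m)
  have hγ : ∀ j, D.γ τ j ∈ LinearMap.range D.rootSum := by
    intro j
    obtain ⟨v, hv⟩ := D.exists_wordProd_eq hτ.mem_weylGroup
    rw [γ, ← hv]
    exact D.sub_wordProd_mem_range v _
  have hfix : ∀ j, (τ ^ m) (D.γ τ j) = D.γ τ j := by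
    intro j
    refine D.eq_of_forall_form_ϖ_eq ?_ (hγ j) fun l => ?_
    · have h := sub_mem (hγ j) (D.sub_wordProd_mem_range w (D.γ τ j))
      rwa [sub_sub_cancel, hw] at h
    · have h1 := hτ.form_ϖ_repetition hξ l j (ξ l + 1 - ξ j)
      have h2 := hτ.form_ϖ_repetition hξ l j (ξ l + 1 - ξ j + 2 * m)
      rw [cheb_add_two_mul hm, ← h1, repetition_two_mul j _ m (by ring),
        repetition_two_mul j _ 0 (by ring)] at h2
      simpa using h2
  refine D.eq_one_of_forall_α (pow_mem hτ.mem_weylGroup m) fun j => ?_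
  have h := hτ.γ_eq j
  rw [← sub_eq_iff_eq_add] at h
  rw [← h, map_sub, map_sum, hfix]
  simp only [map_zsmul, hfix]

theorem IsCoxeterElementOf.cheb_add_of_pow_eq_one (hτ : D.IsCoxeterElementOf ξ τ)
    (hξ : D.IsHeightFunction ξ) {k : ℕ} (hk : τ ^ k = 1) (u : ℤ) :
    D.cheb (u + 2 * k) = D.cheb u := by
  ext l j
  have h1 := hτ.form_ϖ_repetition hξ l j u
  have h2 := hτ.form_ϖ_repetition hξ l j (u + 2 * k)
  have h3 : repetition ξ τ D j (ξ l + 1 - (u + 2 * k)) = repetition ξ τ D j (ξ l + 1 - u) := by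
    rcases Int.even_or_odd' (ξ j - (ξ l + 1 - u)) with ⟨q, hq | hq⟩
    · rw [repetition_two_mul j _ (q + k) (by omega), repetition_two_mul j _ q (by omega),
        zpow_add, zpow_natCast, hk, mul_one]
    · rw [repetition, repetition, if_neg (by grind), if_neg (by grind)]
  rw [h3, h1] at h2
  exact_mod_cast (mul_left_cancel₀ (D.d_pos l).ne' h2).symm

theorem dvd_of_cheb_two_mul {m : ℕ} (hm1 : 1 < m) (hm : D.cheb m = 0)
    (hne : ∀ n : ℕ, 0 < n → n < m → D.cheb n ≠ 0)
    (hnn : ∀ n : ℕ, n ≤ m → ∀ i j, 0 ≤ D.cheb n i j) {k : ℕ}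
    (hk0 : D.cheb (2 * k) = 0) (hk1 : D.cheb (2 * k + 1) = 1) : m ∣ k := by
  have hper : ∀ (q : ℕ) (u : ℤ), D.cheb (u + 2 * m * q) = D.cheb u := by
    intro q
    induction q with
    | zero => simp
    | succ q ih =>
      intro u
      rw [← ih u, ← cheb_add_two_mul hm (u + 2 * m * q)]
      congr 1
      push_cast
      ring
  have hdm : (k : ℤ) = m * (k / m : ℕ) + (k % m : ℕ) := by exact_mod_cast (Nat.div_add_mod k m).symm
  have hr0 : D.cheb (2 * (k % m : ℕ)) = 0 := by
    rw [← hper (k / m), ← hk0, hdm]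
    congr 1
    ring
  have hr1 : D.cheb (2 * (k % m : ℕ) + 1) = 1 := by
    rw [← hper (k / m), ← hk1, hdm]
    congr 1
    ring
  have hlt := Nat.mod_lt k (by omega : m > 0)
  rw [Nat.dvd_iff_mod_eq_zero]
  generalize k % m = r at hr0 hr1 hlt
  by_contra hr
  -- A zero at 2r < m contradicts minimality; for 2r > m, reflection about m moves it to 2m - 2r. If
  -- 2r = m, then `cheb (m + 1)` = -`cheb (m - 1)` has nonpositive diagonal and cannot be 1.
  rcases lt_trichotomy (2 * r) m with h | h | h
  · exact hne (2 * r) (by omega) h (by exact_mod_cast hr0)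
  · have h1 := cheb_add_eq_neg_cheb_sub hm 1
    rw [show (m : ℤ) + 1 = 2 * r + 1 by omega, hr1] at h1
    obtain ⟨j⟩ := D.diagram_connected.nonempty
    have h2 := hnn (m - 1) (by omega) j j
    have h3 := congrFun (congrFun h1 j) j
    rw [Matrix.one_apply_eq, Matrix.neg_apply] at h3
    rw [Nat.cast_sub hm1.le, Nat.cast_one] at h2
    omega
  · have h1 := cheb_add_eq_neg_cheb_sub hm (2 * r - m)
    rw [add_sub_cancel, hr0, show (m : ℤ) - (2 * r - m) = (2 * m - 2 * r : ℕ) by omega] at h1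
    exact hne (2 * m - 2 * r) (by omega) (by omega) (neg_eq_zero.1 h1.symm)

theorem IsCoxeterElementOf.orderOf_eq (hτ : D.IsCoxeterElementOf ξ τ)
    (hξ : D.IsHeightFunction ξ) {m : ℕ} (hm1 : 1 < m) (hm : D.cheb m = 0)
    (hne : ∀ n : ℕ, 0 < n → n < m → D.cheb n ≠ 0)
    (hnn : ∀ n : ℕ, n ≤ m → ∀ i j, 0 ≤ D.cheb n i j) : orderOf τ = m := by
  refine Nat.dvd_antisymm (orderOf_dvd_of_pow_eq_one (hτ.pow_eq_one hξ hm)) ?_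
  have h := hτ.cheb_add_of_pow_eq_one hξ (pow_orderOf_eq_one τ)
  refine dvd_of_cheb_two_mul hm1 hm hne hnn ?_ ?_
  · rw [← zero_add (2 * _), h, cheb_zero]
  · rw [add_comm, h, cheb_one]

end coxeter

/-- This covers the arbitrary enumeration in the definition of the Coxeter number without using
conjugacy of Coxeter elements. -/
theorem exists_isCoxeterElementOf_wordProd {l : List I} (hl : l.Nodup)
    (hmem : ∀ i, i ∈ l) :
    ∃ ξ, D.IsHeightFunction ξ ∧ D.IsCoxeterElementOf ξ (D.wordProd l) := by
  obtain ⟨ξ, hξ, hr⟩ := D.exists_isHeightFunction_of_rank (r := fun i => l.idxOf i)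
    fun i j h => (List.idxOf_inj (hmem i)).1 h
  refine ⟨ξ, hξ, l, hl, hmem, (D.isAdapted_iff hl).2 ?_, rfl⟩
  rintro l₁ j l₂ rfl k hjk
  have hj1 : j ∉ l₁ := fun h => (List.nodup_append.1 hl).2.2 j h j (by simp) rfl
  split_ifs with hk
  · have := hξ.eq_or hjk
    omega
  · rw [sub_zero]
    refine hr j k hjk ?_
    rw [List.idxOf_append_of_notMem hj1, List.idxOf_append_of_notMem hk, List.idxOf_cons_self,
      List.idxOf_cons_ne _ hjk.ne]
    omega

theorem coxeterNumber_eq {m : ℕ} (hm1 : 1 < m) (hm : D.cheb m = 0)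
    (hne : ∀ n : ℕ, 0 < n → n < m → D.cheb n ≠ 0)
    (hnn : ∀ n : ℕ, n ≤ m → ∀ i j, 0 ≤ D.cheb n i j) : D.coxeterNumber = m := by
  obtain ⟨ξ, hξ, hτ⟩ := D.exists_isCoxeterElementOf_wordProd
    (Finset.nodup_toList (Finset.univ : Finset I)) (by simp)
  exact hτ.orderOf_eq hξ hm1 hm hne hnn

end FiniteCartanDatum

/-! ### The theorem, read off from the Chebyshev values -/

theorem mainTheorem2 {I P : Type*} [Fintype I] [DecidableEq I] [AddCommGroup P] [Module.Free ℤ P]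
    (D : FiniteCartanDatum I P) :
    ∃ (w₀ : P ≃ₗ[ℤ] P) (star : I → I),
      -- `w₀` is the longest element and `star` the involution that it induces
      (∀ w, D.IsLongest w ↔ w = w₀) ∧ (∀ i, w₀ (D.α i) = -D.α (star i)) ∧
      -- parity vanishing
      (∀ (i j : I) (u : ℤ), ¬(1 ≤ u ∧ u ≡ D.diagram.dist i j + 1 [ZMOD 2]) → D.b i j u = 0) ∧
      -- anti-periodicity
      (∀ (i j : I) (u : ℤ), 0 ≤ u → D.b i j (u + D.coxeterNumber) = -D.b i (star j) u) ∧
      (∀ i j : I, D.b i j D.coxeterNumber = 0) ∧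
      -- periodicity
      (∀ (i j : I) (u : ℤ), 0 ≤ u → D.b i j (u + 2 * D.coxeterNumber) = D.b i j u) ∧
      -- reflection symmetries
      (∀ (i j : I) (u : ℤ), 0 ≤ u → u ≤ D.coxeterNumber →
        D.b i j (D.coxeterNumber - u) = D.b i (star j) u) ∧
      (∀ (i j : I) (u : ℤ), 0 ≤ u → u ≤ 2 * D.coxeterNumber →
        D.b i j (2 * D.coxeterNumber - u) = -D.b i j u) ∧
      -- signs
      (∀ (i j : I) (u : ℤ), 0 ≤ u → u ≤ D.coxeterNumber → 0 ≤ D.b i j u) ∧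
      (∀ (i j : I) (u : ℤ), D.coxeterNumber ≤ u → u ≤ 2 * D.coxeterNumber → D.b i j u ≤ 0) ∧
      -- formula through Coxeter elements
      (∀ ξ : I → ℤ, D.IsHeightFunction ξ → ∀ τ : P ≃ₗ[ℤ] P, D.IsCoxeterElementOf ξ τ →
        ∀ (i j : I) (u : ℤ), D.b i j u - D.b i j (-u) =
          if Even (u + ξ j - ξ i - 1) then
            D.form (D.ϖ i) ((τ ^ ((u + ξ j - ξ i - 1) / 2)) (D.γ τ j))
          else 0) := by
  obtain ⟨m, hm1, hm, hne, hnn⟩ := D.exists_first_zero_cheb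
  rw [D.coxeterNumber_eq hm1 hm hne hnn]
  have hnn' : ∀ u : ℤ, 0 ≤ u → u ≤ m → ∀ i j, 0 ≤ D.cheb u i j := by
    intro u h0 h1 i j
    obtain ⟨n, rfl⟩ := Int.eq_ofNat_of_zero_le h0
    exact hnn n (by exact_mod_cast h1) i j
  obtain ⟨σ, hσ⟩ := FiniteCartanDatum.exists_star hm (hnn' (m - 1) (by omega) (by omega))
  obtain ⟨w₀, hw₀, hwσ⟩ := FiniteCartanDatum.exists_mem_weylGroup_α_eq_neg hm hσ
  have hadd : ∀ (i j : I) (u : ℤ), D.cheb (u + m) i j = -D.cheb u i (σ j) := by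
    intro i j u
    rw [add_comm, FiniteCartanDatum.cheb_add_eq_neg_cheb_sub hm, Matrix.neg_apply,
      FiniteCartanDatum.cheb_sub_apply hm hσ]
  refine ⟨w₀, σ, D.isLongest_iff hw₀ hwσ, hwσ, fun i j u h => ?_, fun i j u h => ?_,
    fun i j => ?_, fun i j u h => ?_, fun i j u h0 h1 => ?_, fun i j u h0 h1 => ?_,
    fun i j u h0 h1 => ?_, fun i j u h0 h1 => ?_, fun ξ hξ τ hτ i j u => ?_⟩
  · rcases lt_or_ge u 1 with hu | hu
    · exact D.b_eq_zero_of_nonpos i j u (by omega)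
    · obtain ⟨ξ, hξ⟩ := D.exists_isHeightFunction
      have h1 := hξ.even_dist i j
      rw [D.b_eq_cheb _ _ _ (by omega), hξ.cheb_eq_zero j u i, Int.cast_zero, mul_zero]
      intro h2
      refine h ⟨hu, ?_⟩
      rw [Int.even_iff] at h1 h2
      rw [Int.ModEq]
      omega
  · rw [D.b_eq_cheb _ _ _ (by omega), D.b_eq_cheb _ _ _ h, hadd]
    push_cast
    ring
  · rw [D.b_eq_cheb _ _ _ (by omega), hm]
    simp
  · rw [D.b_eq_cheb _ _ _ (by omega), D.b_eq_cheb _ _ _ h,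
      FiniteCartanDatum.cheb_add_two_mul hm]
  · rw [D.b_eq_cheb _ _ _ (by omega), D.b_eq_cheb _ _ _ h0,
      FiniteCartanDatum.cheb_sub_apply hm hσ]
  · rw [D.b_eq_cheb _ _ _ (by omega), D.b_eq_cheb _ _ _ h0, sub_eq_neg_add,
      FiniteCartanDatum.cheb_add_two_mul hm, D.cheb_neg]
    simp
  · rw [D.b_eq_cheb _ _ _ h0]
    exact mul_nonneg (D.d_pos i).le (by exact_mod_cast hnn' u h0 h1 i j)
  · rw [D.b_eq_cheb _ _ _ (by omega), ← sub_add_cancel u m, hadd]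
    have := hnn' (u - m) (by omega) (by omega) i (σ j)
    exact mul_nonpos_of_nonneg_of_nonpos (D.d_pos i).le (by exact_mod_cast neg_nonpos.2 this)
  · rw [D.b_sub_b_neg, ← hτ.form_ϖ_repetition hξ, FiniteCartanDatum.repetition,
      show ξ j - (ξ i + 1 - u) = u + ξ j - ξ i - 1 by ring]
    split_ifs
    · rfl
    · rw [map_zero]
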